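/- A \emph{pivotal participation game} $(\vec e,\vec m,\tau)$ has $n\ge 0$ agents with endowments $e_i\ge 0$ and reward levels $0<m_i<1$, and a threshold $\tau\ge 0$. For a set $S\subseteq[n]$ of participating agents let $e(S)=\sum_{j\in S}e_j$; the project succeeds if $e(S)\ge\tau$, and the utility of agent $i$ is $$U_i(S)=e_i\,\mathbf 1[i\notin S]+m_i\,e(S)\,\mathbf 1[e(S)\ge\tau].$$ The set $S$ is a \emph{cooperative Nash equilibrium} if $e(S)\ge\tau$, $U_i(S)\ge U_i(S\setminus\{i\})$ for all $i\in S$, and $U_i(S)\ge U_i(S\cup\{i\})$ for all $i\notin S$. The set $S$ is \emph{minimal} if $e(S)\ge\tau$ and $e(S\setminus\{j\})<\tau$ for every $j\in S$. The game is \emph{balanced} if all its minimal sets have the same cardinality. \textbf{Theorem.} Deciding the existence of a cooperative Nash equilibrium is in P for balanced pivotal participation games: with instances $(\vec e,\vec m,\tau)$ whose entries are rational numbers, written as numerators and denominators in binary, there is a language $L$ in P (decided by a deterministic Turing machine in time polynomial in the length of the input, on every input string) such that for every balanced instance, its encoding belongs to $L$ if and only if the instance has a cooperative Nash equilibrium.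 -/

import Mathlib

/-- A pivotal participation game with `n` agents: endowments `e i ≥ 0`, reward levels
`0 < m i < 1` and a threshold `τ ≥ 0`. -/
structure PivotalGame (n : ℕ) where
  e : Fin n → ℝ
  m : Fin n → ℝ
  τ : ℝ
  e_nonneg : ∀ i, 0 ≤ e i
  m_pos : ∀ i, 0 < m i
  m_lt_one : ∀ i, m i < 1
  τ_nonneg : 0 ≤ τ

namespace PivotalGame

variable {n : ℕ} (G : PivotalGame n)

/-- `e(S)`: the total contribution when exactly the agents in `S` participate. -/
def contribution (S : Finset (Fin n)) : ℝ := ∑ j ∈ S, G.e j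

/-- The project succeeds when the agents in `S` participate. -/
def Succeeds (S : Finset (Fin n)) : Prop := G.τ ≤ G.contribution S

open Classical in
/-- `U_i(S) = e_i 1[i ∉ S] + m_i e(S) 1[e(S) ≥ τ]`. -/
noncomputable def utility (i : Fin n) (S : Finset (Fin n)) : ℝ :=
  (if i ∉ S then G.e i else 0) + (if G.Succeeds S then G.m i * G.contribution S else 0)

/-- No agent gains by a unilateral deviation. -/
def IsNash (S : Finset (Fin n)) : Prop :=
  (∀ i ∈ S, G.utility i (S.erase i) ≤ G.utility i S) ∧
    (∀ i ∉ S, G.utility i (insert i S) ≤ G.utility i S)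

/-- A Nash equilibrium at which the project succeeds. -/
def IsCooperativeNash (S : Finset (Fin n)) : Prop := G.IsNash S ∧ G.Succeeds S

/-- `S` succeeds, and removing any single member makes the project fail. -/
def IsMinimal (S : Finset (Fin n)) : Prop :=
  G.Succeeds S ∧ ∀ j ∈ S, G.contribution (S.erase j) < G.τ

/-- All minimal subsets of agents have the same cardinality. -/
def IsBalanced : Prop :=
  ∀ S T : Finset (Fin n), G.IsMinimal S → G.IsMinimal T → S.card = T.card

end PivotalGame

/-- A pivotal participation game whose parameters are rational numbers, so that it can be written
down as a finite string. -/
structure RationalInstance where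
  n : ℕ
  e : Fin n → ℚ
  m : Fin n → ℚ
  τ : ℚ
  e_nonneg : ∀ i, 0 ≤ e i
  m_pos : ∀ i, 0 < m i
  m_lt_one : ∀ i, m i < 1
  τ_nonneg : 0 ≤ τ

namespace RationalInstance

/-- The pivotal participation game described by a rational instance. -/
noncomputable def toGame (I : RationalInstance) : PivotalGame I.n where
  e i := (I.e i : ℝ)
  m i := (I.m i : ℝ)
  τ := (I.τ : ℝ)
  e_nonneg i := by exact_mod_cast I.e_nonneg i
  m_pos i := by exact_mod_cast I.m_pos i
  m_lt_one i := by exact_mod_cast I.m_lt_one i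
  τ_nonneg := by exact_mod_cast I.τ_nonneg

/-- A nonnegative rational as its numerator and denominator in lowest terms. -/
def ratData (q : ℚ) : List ℕ := [q.num.toNat, q.den]

/-- The sequence `τ, e_1, m_1, …, e_n, m_n`, each entry as numerator and denominator. -/
def data (I : RationalInstance) : List ℕ :=
  ratData I.τ ++ (List.finRange I.n).flatMap fun i => ratData (I.e i) ++ ratData (I.m i)

/-- A natural number in binary, terminated by a comma. -/
def encodeNatField (k : ℕ) : List Computability.Γ' :=
  (Computability.encodeNat k).map Computability.Γ'.bit ++ [Computability.Γ'.comma]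

/-- The input string: the entries of `data` in binary, each terminated by a comma. -/
def encode (I : RationalInstance) : List Computability.Γ' := I.data.flatMap encodeNatField

theorem encodeNatField_append_inj {a b : ℕ} {u v : List Computability.Γ'}
    (h : encodeNatField a ++ u = encodeNatField b ++ v) : a = b ∧ u = v := by
  have key : ∀ (x y : List Bool),
      x.map Computability.Γ'.bit ++ Computability.Γ'.comma :: u =
        y.map Computability.Γ'.bit ++ Computability.Γ'.comma :: v → x = y ∧ u = v := by
    intro x
    induction x with
    | nil => intro y hy; cases y <;> simp_all
    | cons c x ih =>
      intro y hy
      cases y with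
      | nil => simp at hy
      | cons d y =>
        simp only [List.map_cons, List.cons_append, List.cons.injEq,
          Computability.Γ'.bit.injEq] at hy
        obtain ⟨h1, h2⟩ := ih y hy.2
        exact ⟨by rw [hy.1, h1], h2⟩
  simp only [encodeNatField, List.append_assoc, List.singleton_append] at h
  obtain ⟨h1, h2⟩ := key _ _ h
  refine ⟨?_, h2⟩
  have := congrArg Computability.decodeNat h1
  simpa using this

theorem flatMap_encodeNatField_injective :
    Function.Injective fun l : List ℕ => l.flatMap encodeNatField := by
  intro l
  induction l with
  | nil => intro l' h; cases l' <;> simp_all [encodeNatField]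
  | cons a l ih =>
    intro l' h
    cases l' with
    | nil => simp [encodeNatField] at h
    | cons b l' =>
      simp only [List.flatMap_cons] at h
      obtain ⟨h1, h2⟩ := encodeNatField_append_inj h
      rw [h1, ih h2]

theorem ratData_inj {p q : ℚ} (hp : 0 ≤ p) (hq : 0 ≤ q) (h : ratData p = ratData q) : p = q := by
  simp only [ratData, List.cons.injEq, and_true] at h
  have h1 := Rat.num_nonneg.2 hp
  have h2 := Rat.num_nonneg.2 hq
  exact Rat.ext (by omega) h.2

/-- Different instances have different input strings. -/
theorem encode_injective : Function.Injective encode := by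
  have split : ∀ {p q : ℚ} {u v : List ℕ}, 0 ≤ p → 0 ≤ q →
      ratData p ++ u = ratData q ++ v → p = q ∧ u = v := by
    intro p q u v hp hq h
    obtain ⟨h1, h2⟩ := List.append_inj h rfl
    exact ⟨ratData_inj hp hq h1, h2⟩
  rintro ⟨n, e, m, τ, he, hm, hm1, hτ⟩ ⟨n', e', m', τ', he', hm', hm1', hτ'⟩ h
  have h := flatMap_encodeNatField_injective h
  obtain ⟨rfl, h⟩ := split hτ hτ' h
  have hn : n = n' := by
    have := congrArg List.length h
    simp [ratData, List.length_flatMap] at this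
    omega
  subst hn
  have key : ∀ l : List (Fin n),
      (l.flatMap fun i => ratData (e i) ++ ratData (m i)) =
        (l.flatMap fun i => ratData (e' i) ++ ratData (m' i)) →
      ∀ i ∈ l, e i = e' i ∧ m i = m' i := by
    intro l
    induction l with
    | nil => simp
    | cons a l ih =>
      intro h
      simp only [List.flatMap_cons, List.append_assoc] at h
      obtain ⟨h1, h⟩ := split (he a) (he' a) h
      obtain ⟨h2, h⟩ := split (hm a).le (hm' a).le h
      intro i hi
      rcases List.mem_cons.1 hi with rfl | hi
      · exact ⟨h1, h2⟩
      · exact ih h i hi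
  have key := fun i => key _ h i (List.mem_finRange i)
  obtain rfl : e = e' := funext fun i => (key i).1
  obtain rfl : m = m' := funext fun i => (key i).2
  rfl

end RationalInstance

open Classical in
/-- The complexity class P: a deterministic multi-stack Turing machine decides membership in `L`
(output `true` or `false`) on every input string, in a number of steps that is bounded by a
polynomial in the length of the string. -/
def InP {Γ : Type} (L : Language Γ) : Prop :=
  Nonempty (Turing.TM2ComputableInPolyTime (id : List Γ → List Γ) Computability.encodeBool
    fun w => decide (w ∈ L))

/-!
**Equilibria.** If `S` is a cooperative equilibrium, then `m_i < 1` forces every member with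
`e_i > 0` to be pivotal, so these members form a minimal set, and each of them satisfies
`e_i / m_i ≤ e(S)`. Conversely, a minimal set all of whose members satisfy this is an equilibrium.
Call `e_i / m_i` the demand of `i`, and let `t` be the largest demand in the minimal set of an
equilibrium. The greedy set of the agents of demand at most `t`, heaviest first, is also minimal.
Balancedness gives both sets the same cardinality, so there is a bijection between the agents that
only one of them contains; since greed prefers heavy agents, the greedy set contributes at least as
much, and it meets all demands up to `t`. So it suffices to test the greedy sets for the demands of
the `n` agents.

**Polynomial time.** Data are binary trees, written in prefix notation on a stack, and the functions
computed on them by structured stack programs in polynomial time are closed under composition,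
pairing, case distinction, and folds whose intermediate values stay polynomially bounded. Structured
programs compile to multi-stack Turing machines instruction by instruction.
-/

open Computability Turing StateTransition

/-! ### Structured programs on stacks -/

/-- The work stacks of a stack program: the serialized input, the main stack, which holds the data,
two auxiliary stacks, and a stack used as a unary counter. -/
inductive Reg
  | input | main | left | right | counter
  deriving DecidableEq

instance : Fintype Reg :=
  ⟨{.input, .main, .left, .right, .counter}, fun r => by cases r <;> decide⟩

/-- The state of a stack program: the register `cur`, which receives the popped symbols (`none` if
the stack was empty), and the contents of the work stacks. -/
structure Store where
  cur : Option Γ'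
  input : List Γ'
  main : List Γ'
  left : List Γ'
  right : List Γ'
  counter : List Γ'

namespace Store

/-- The contents of the stack `r`. -/
def get (s : Store) : Reg → List Γ'
  | .input => s.input
  | .main => s.main
  | .left => s.left
  | .right => s.right
  | .counter => s.counter

/-- Replace the contents of one stack by `l`. -/
def set (s : Store) (l : List Γ') : Reg → Store
  | .input => { s with input := l }
  | .main => { s with main := l }
  | .left => { s with left := l }
  | .right => { s with right := l }
  | .counter => { s with counter := l }

end Store

/-- The stack alphabets of the machines below: besides the work stacks there is an output stack
`none` of Booleans. -/
abbrev Alphabet : Option Reg → Type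
  | none => Bool
  | some _ => Γ'

/-- The machine code attached to one label of a machine with labels `Λ`. -/
abbrev Code (Λ : Type) := TM2.Stmt Alphabet Λ (Option Γ')

namespace Store

/-- The stacks of a machine with empty output stack. -/
def stk (s : Store) : (k : Option Reg) → List (Alphabet k)
  | none => ([] : List Bool)
  | some r => s.get r

/-- The configuration of a machine at the label `l`, with empty output stack. -/
def cfg {Λ : Type} (s : Store) (l : Λ) : TM2.Cfg Alphabet Λ (Option Γ') := ⟨some l, s.cur, s.stk⟩

theorem cfg_set {Λ : Type} (s : Store) (l : List Γ') (r : Reg) (a : Λ) :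
    (s.set l r).cfg a = ⟨some a, s.cur, Function.update s.stk (some r) l⟩ := by
  have hcur : (s.set l r).cur = s.cur := by cases r <;> rfl
  refine (congrArg (TM2.Cfg.mk _ · _) hcur).trans (congrArg (TM2.Cfg.mk _ _) (funext fun k => ?_))
  rcases k with _ | k
  · rfl
  · cases r <;> cases k <;> simp [stk, set, get, Function.update]

theorem cfg_with_cur {Λ : Type} (s : Store) (x : Option Γ') (a : Λ) :
    ({ s with cur := x } : Store).cfg a = ⟨some a, x, s.stk⟩ := by
  refine congrArg (TM2.Cfg.mk _ _) (funext fun k => ?_)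
  rcases k with _ | k
  · rfl
  · cases k <;> rfl

end Store

/-- A program fragment: a finite set of labels with an entry point, and machine code for each label
which is parametric in an embedding of the labels into those of a whole machine and in the label at
which the machine continues after the fragment. -/
structure Prog where
  Lab : Type
  [fintype : Fintype Lab]
  entry : Lab
  code : ∀ {Λ : Type}, (Lab → Λ) → (exit : Λ) → Lab → Code Λ

attribute [instance] Prog.fintype

namespace Prog

/-- The fragment consisting of a single instruction. -/
def instr (c : ∀ {Λ : Type}, Code Λ → Code Λ) : Prog where
  Lab := Unit
  entry := ()
  code _ exit _ := c (.goto fun _ => exit)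

/-- Do nothing. -/
def skip : Prog := instr id

/-- Push a symbol computed from the register `cur` to the stack `r`. -/
def push (r : Reg) (f : Option Γ' → Γ') : Prog := instr (.push (some r) f)

/-- Pop the stack `r` into the register `cur`. -/
def pop (r : Reg) : Prog := instr (.pop (some r) fun _ x => x)

/-- Sequential composition. -/
def seq (p q : Prog) : Prog where
  Lab := p.Lab ⊕ q.Lab
  entry := .inl p.entry
  code emb exit := Sum.elim (p.code (emb ∘ .inl) (emb (.inr q.entry))) (q.code (emb ∘ .inr) exit)

/-- Branch on a test `t` of the register `cur`. -/
def cond (t : Option Γ' → Bool) (p q : Prog) : Prog where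
  Lab := Option (p.Lab ⊕ q.Lab)
  entry := none
  code emb exit l := l.elim
    (.branch t (.goto fun _ => emb (some (.inl p.entry)))
      (.goto fun _ => emb (some (.inr q.entry))))
    (Sum.elim (p.code (emb ∘ some ∘ .inl) exit) (q.code (emb ∘ some ∘ .inr) exit))

/-- Repeat `p` as long as the register `cur` passes the test `t`. -/
def loop (t : Option Γ' → Bool) (p : Prog) : Prog where
  Lab := Option p.Lab
  entry := none
  code emb exit l := l.elim
    (.branch t (.goto fun _ => emb (some p.entry)) (.goto fun _ => exit))
    (p.code (emb ∘ some) (emb none))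

end Prog

infixr:60 ";;" => Prog.seq

/-- `Run p s u k`: started in `s`, the program `p` terminates in `u` after at most `k` steps, inside
every machine that contains its code. -/
def Run (p : Prog) (s u : Store) (k : ℕ) : Prop :=
  ∀ (Λ : Type) (M : Λ → Code Λ) (emb : p.Lab → Λ) (exit : Λ),
    (∀ l, M (emb l) = p.code emb exit l) →
      Nonempty (EvalsToInTime (TM2.step M) (s.cfg (emb p.entry)) (some (u.cfg exit)) k)

namespace Run

variable {p q : Prog} {t : Option Γ' → Bool} {s u w : Store} {j k : ℕ}

theorem nonempty_evalsToInTime_succ {σ : Type*} {f : σ → Option σ} {a b : σ} {c : Option σ}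
    (h : f a = some b) (e : Nonempty (EvalsToInTime f b c k)) :
    Nonempty (EvalsToInTime f a c (k + 1)) :=
  e.map (EvalsToInTime.trans f 1 k a b c ⟨⟨1, h⟩, le_rfl⟩)

theorem of_step (h : ∀ {Λ : Type} {M : Λ → Code Λ} (emb : p.Lab → Λ) (exit : Λ),
    (∀ l, M (emb l) = p.code emb exit l) →
      TM2.step M (s.cfg (emb p.entry)) = some (u.cfg exit)) : Run p s u 1 :=
  fun _ _ emb exit hM => nonempty_evalsToInTime_succ (h emb exit hM) ⟨.refl _ _⟩

theorem step_cfg {Λ : Type} {M : Λ → Code Λ} {l : Λ} {c : Code Λ} (h : M l = c) (s : Store) :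
    TM2.step M (s.cfg l) = some (TM2.stepAux c s.cur s.stk) :=
  h ▸ rfl

theorem skip (s : Store) : Run .skip s s 1 :=
  of_step fun _ _ hM => step_cfg (hM ()) s

theorem push (r : Reg) (f : Option Γ' → Γ') (s : Store) :
    Run (.push r f) s (s.set (f s.cur :: s.get r) r) 1 :=
  of_step fun _ _ hM => (step_cfg (hM ()) s).trans (by rw [s.cfg_set]; rfl)

theorem pop (r : Reg) (s : Store) :
    Run (.pop r) s { s.set (s.get r).tail r with cur := (s.get r).head? } 1 :=
  of_step fun _ exit hM => (step_cfg (hM ()) s).trans (by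
    rw [Store.cfg_with_cur, (TM2.Cfg.mk.inj (s.cfg_set _ r exit)).2.2]; rfl)

theorem weaken (h : Run p s u j) (hjk : j ≤ k) : Run p s u k := fun _ _ emb exit hM =>
  (h _ _ emb exit hM).map fun e => { e with steps_le_m := e.steps_le_m.trans hjk }

theorem seq (hp : Run p s u j) (hq : Run q u w k) : Run (p ;; q) s w (j + k) :=
  fun _ _ emb exit hM => by
    obtain ⟨ep⟩ := hp _ _ (emb ∘ .inl) (emb (.inr q.entry)) fun l => hM (.inl l)
    obtain ⟨eq⟩ := hq _ _ (emb ∘ .inr) exit fun l => hM (.inr l)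
    exact ⟨add_comm k j ▸ EvalsToInTime.trans _ _ _ _ _ _ ep eq⟩

theorem step_branch {Λ : Type} {M : Λ → Code Λ} {l a b : Λ}
    (h : M l = .branch t (.goto fun _ => a) (.goto fun _ => b)) (s : Store) :
    TM2.step M (s.cfg l) = some (s.cfg (if t s.cur then a else b)) := by
  rw [step_cfg h]
  cases ht : t s.cur <;> simp [Store.cfg, TM2.stepAux, ht]

theorem cond_true (ht : t s.cur = true) (h : Run p s u k) : Run (.cond t p q) s u (k + 1) :=
  fun _ _ emb exit hM => nonempty_evalsToInTime_succ
    ((step_branch (hM none) s).trans (by rw [if_pos ht]; rfl))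
    (h _ _ (emb ∘ some ∘ .inl) exit fun l => hM (some (.inl l)))

theorem cond_false (ht : t s.cur = false) (h : Run q s u k) : Run (.cond t p q) s u (k + 1) :=
  fun _ _ emb exit hM => nonempty_evalsToInTime_succ
    ((step_branch (hM none) s).trans (by rw [if_neg (by simp [ht])]; rfl))
    (h _ _ (emb ∘ some ∘ .inr) exit fun l => hM (some (.inr l)))

theorem loop_done (ht : t s.cur = false) : Run (.loop t p) s s 1 :=
  of_step fun _ _ hM => (step_branch (hM none) s).trans (by rw [if_neg (by simp [ht])])

theorem loop_step (ht : t s.cur = true) (hp : Run p s u j) (hl : Run (.loop t p) u w k) :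
    Run (.loop t p) s w (j + k + 1) := fun _ _ emb exit hM => by
  obtain ⟨ep⟩ := hp _ _ (emb ∘ some) (emb none) fun l => hM (some l)
  obtain ⟨el⟩ := hl _ _ emb exit hM
  exact nonempty_evalsToInTime_succ ((step_branch (hM none) s).trans (by rw [if_pos ht]; rfl))
    ⟨add_comm k j ▸ EvalsToInTime.trans _ _ _ _ _ _ ep el⟩

end Run

/-! ### Compilation to a multi-stack Turing machine -/

/-- The machine that runs `p` on its input and then outputs whether the register `cur` holds the
symbol `x`. -/
noncomputable def Prog.machine (p : Prog) (x : Γ') : FinTM2 where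
  K := Option Reg
  k₀ := some .input
  k₁ := none
  Γ := Alphabet
  Λ := Option p.Lab
  main := some p.entry
  σ := Option Γ'
  initialState := none
  Γk₀Fin := inferInstanceAs (Fintype Γ')
  m l := l.elim
    (.push none (fun y => (decide (y = some x) : Bool)) (.load (fun _ => none) .halt))
    (p.code some none)

theorem Prog.initList_machine (p : Prog) (x : Γ') (w : List Γ') :
    initList (p.machine x) (w.map (Equiv.refl Γ').invFun) =
      Store.cfg ⟨none, w, [], [], [], []⟩ (some p.entry) := by
  refine congrArg (TM2.Cfg.mk _ _) (funext fun k => ?_)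
  rcases k with _ | k
  · rfl
  · cases k
    case input => exact List.map_id w
    all_goals rfl

theorem Prog.step_machine_exit (p : Prog) (x : Γ') (y : Option Γ') :
    TM2.step (p.machine x).m (Store.cfg ⟨y, [], [], [], [], []⟩ none) =
      some (haltList (p.machine x) [decide (y = some x)]) := by
  refine congrArg some (congrArg (TM2.Cfg.mk _ _) (funext fun k => ?_))
  rcases k with _ | k
  · rfl
  · cases k <;> rfl

open Classical in
theorem InP.of_run {L : Language Γ'} (p : Prog) (x : Γ') (t : Polynomial ℕ)
    (h : ∀ w : List Γ', ∃ y, Run p ⟨none, w, [], [], [], []⟩ ⟨y, [], [], [], [], []⟩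
      (t.eval w.length) ∧ (y = some x ↔ w ∈ L)) : InP L := by
  have outputs (w : List Γ') : Nonempty (TM2OutputsInTime (p.machine x)
      (w.map (Equiv.refl Γ').invFun) (some [decide (w ∈ L)]) ((t + 1).eval w.length)) := by
    obtain ⟨y, hrun, hy⟩ := h w
    obtain ⟨e⟩ := hrun _ (p.machine x).m some none fun _ => rfl
    have last := p.step_machine_exit x y
    rw [show decide (y = some x) = decide (w ∈ L) from decide_eq_decide.2 hy] at last
    rw [TM2OutputsInTime, p.initList_machine, add_comm, Polynomial.eval_add, Polynomial.eval_one]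
    exact ⟨EvalsToInTime.trans _ _ 1 _ _ _ e ⟨⟨1, last⟩, le_rfl⟩⟩
  exact ⟨{ tm := p.machine x, inputAlphabet := Equiv.refl Γ', outputAlphabet := Equiv.refl Bool,
           time := t + 1, outputsFun := fun w => (outputs w).some }⟩

/-! ### Binary trees on the main stack -/

/-- Prefix notation of a binary tree. -/
def serialize : BinaryTree Unit → List Γ'
  | .nil => [.ket]
  | .node _ l r => .bra :: (serialize l ++ serialize r)

theorem blank_notMem_serialize (d : BinaryTree Unit) : Γ'.blank ∉ serialize d := by
  induction d with
  | nil => simp [serialize]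
  | node _ l r hl hr => simp [serialize, hl, hr]

namespace Prog

/-- Push the symbol `x`. -/
def pushSym (r : Reg) (x : Γ') : Prog := push r fun _ => x

/-- Push the symbol in the register `cur`. -/
def pushCur (r : Reg) : Prog := push r fun v => v.getD .blank

/-- Push a word to the main stack, so that its first symbol is the topmost one. -/
def pushWord (w : List Γ') : Prog := w.foldr (fun x p => p ;; pushSym .main x) skip

/-- One round of `lift`: an inner node adds its two subtrees to the trees to come, of which the next
one is then taken off the counter. -/
def liftSymbol (p : Prog) : Prog :=
  pop .main ;; p ;;
    cond (· == some .bra) (pushSym .counter .blank ;; pushSym .counter .blank) skip ;;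
    pop .counter

/-- Remove the topmost tree from the main stack, running `p` after each popped symbol. While the
tree is read, the register `cur` and the counter together hold one symbol for each subtree that is
still to come. -/
def lift (p : Prog) : Prog :=
  pushSym .counter .blank ;; pop .counter ;; loop Option.isSome (liftSymbol p)

/-- Move the symbols of the stack `r` down to the next blank to the main stack. -/
def lower (r : Reg) : Prog := pop r ;; loop (· != some .blank) (pushCur .main ;; pop r)

/-- Remove the topmost tree from the main stack. -/
def drop : Prog := lift skip

/-- Duplicate the topmost tree of the main stack. -/
def dup : Prog :=
  pushSym .left .blank ;; pushSym .right .blank ;; lift (pushCur .left ;; pushCur .right) ;;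
    lower .left ;; lower .right

/-- Swap the two topmost trees of the main stack. -/
def swap : Prog :=
  pushSym .left .blank ;; lift (pushCur .left) ;; pushSym .right .blank ;;
    lift (pushCur .right) ;; lower .left ;; lower .right

end Prog

namespace Run

open Prog

theorem pushWord (w : List Γ') (v : Option Γ') (i A B C N : List Γ') :
    Run (pushWord w) ⟨v, i, A, B, C, N⟩ ⟨v, i, w ++ A, B, C, N⟩ (w.length + 1) := by
  induction w with
  | nil => exact .skip _
  | cons x w ih => exact (ih.seq (.push _ _ _)).weaken (by simp)

section lift

variable {p : Prog} {i : List Γ'} {L R : List Γ' → List Γ'} {k : ℕ}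
  (hp : ∀ x A X N, Run p ⟨some x, i, A, L X, R X, N⟩ ⟨some x, i, A, L (x :: X), R (x :: X), N⟩ k)
include hp

theorem lift_loop (d : BinaryTree Unit) {x : Γ'} {A X N : List Γ'} {u : Store} {m : ℕ}
    (h : Run (.loop Option.isSome (liftSymbol p))
      ⟨N.head?, i, A, L ((serialize d).reverse ++ X), R ((serialize d).reverse ++ X), N.tail⟩ u m) :
    Run (.loop Option.isSome (liftSymbol p)) ⟨some x, i, serialize d ++ A, L X, R X, N⟩ u
      (m + (k + 6) * (serialize d).length) := by
  induction d generalizing x A X N m with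
  | nil =>
    exact (loop_step rfl ((Run.pop _ _).seq ((hp _ _ _ _).seq
      ((cond_false rfl (.skip _)).seq (.pop _ _)))) h).weaken
      (by simp only [serialize, List.length_singleton]; lia)
  | node _ l r hl hr =>
    simp only [serialize, List.reverse_cons, List.reverse_append, List.append_assoc] at h
    have subtrees := hl (x := .blank) (A := serialize r ++ A) (N := .blank :: N)
      (hr (x := .blank) (N := N) h)
    rw [serialize, List.cons_append, List.append_assoc]
    refine (loop_step rfl ((Run.pop _ _).seq ((hp _ _ _ _).seq ((cond_true rfl
      ((Run.push _ _ _).seq (.push _ _ _))).seq (.pop _ _)))) subtrees).weaken ?_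
    simp only [List.length_cons, List.length_append]
    lia

theorem lift (d : BinaryTree Unit) (v : Option Γ') (A : List Γ') :
    Run (lift p) ⟨v, i, serialize d ++ A, L [], R [], []⟩
      ⟨none, i, A, L (serialize d).reverse, R (serialize d).reverse, []⟩
      ((k + 6) * (serialize d).length + 3) := by
  have := lift_loop hp d (x := .blank) (A := A) (X := []) (N := []) (loop_done rfl)
  rw [List.append_nil] at this
  exact ((Run.push _ _ _).seq ((Run.pop _ _).seq this)).weaken (by lia)

end lift

theorem lower {r : Reg} {S : Option Γ' → List Γ' → List Γ' → Store}
    (hcur : ∀ v A X, (S v A X).cur = v)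
    (hpop : ∀ v A X, Run (.pop r) (S v A X) (S X.head? A X.tail) 1)
    (hpush : ∀ x A X, Run (pushCur .main) (S (some x) A X) (S (some x) (x :: A) X) 1)
    {w : List Γ'} (hw : Γ'.blank ∉ w) (v : Option Γ') (A X : List Γ') :
    Run (lower r) (S v A (w ++ .blank :: X)) (S (some .blank) (w.reverse ++ A) X)
      (3 * w.length + 2) := by
  suffices h : Run (.loop (· != some .blank) (pushCur .main ;; .pop r))
      (S (w ++ .blank :: X).head? A (w ++ .blank :: X).tail)
      (S (some .blank) (w.reverse ++ A) X) (3 * w.length + 1) from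
    ((hpop _ _ _).seq h).weaken (by lia)
  induction w generalizing A with
  | nil => exact loop_done (by simp [hcur])
  | cons x w ih =>
    obtain ⟨hx, hw⟩ := not_or.1 (List.mem_cons.not.1 hw)
    rw [List.reverse_cons, List.append_assoc]
    exact (loop_step (by simpa [hcur] using Ne.symm hx) ((hpush _ _ _).seq (hpop _ _ _))
      (ih hw (x :: A))).weaken (by rw [List.length_cons]; lia)

theorem lower_left {w : List Γ'} (hw : Γ'.blank ∉ w) (v : Option Γ') (i A B C : List Γ') :
    Run (Prog.lower .left) ⟨v, i, A, w ++ .blank :: B, C, []⟩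
      ⟨some .blank, i, w.reverse ++ A, B, C, []⟩ (3 * w.length + 2) :=
  lower (S := fun v A X => ⟨v, i, A, X, C, []⟩) (fun _ _ _ => rfl) (fun _ _ _ => .pop _ _)
    (fun _ _ _ => .push _ _ _) hw v A B

theorem lower_right {w : List Γ'} (hw : Γ'.blank ∉ w) (v : Option Γ') (i A B C : List Γ') :
    Run (Prog.lower .right) ⟨v, i, A, B, w ++ .blank :: C, []⟩
      ⟨some .blank, i, w.reverse ++ A, B, C, []⟩ (3 * w.length + 2) :=
  lower (S := fun v A X => ⟨v, i, A, B, X, []⟩) (fun _ _ _ => rfl) (fun _ _ _ => .pop _ _)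
    (fun _ _ _ => .push _ _ _) hw v A C

theorem drop (d : BinaryTree Unit) (v : Option Γ') (i A B C : List Γ') :
    Run drop ⟨v, i, serialize d ++ A, B, C, []⟩ ⟨none, i, A, B, C, []⟩
      (7 * (serialize d).length + 3) :=
  lift (L := fun _ => B) (R := fun _ => C) (fun _ _ _ _ => .skip _) d v A

theorem dup (d : BinaryTree Unit) (v : Option Γ') (i A B C : List Γ') :
    Run dup ⟨v, i, serialize d ++ A, B, C, []⟩
      ⟨some .blank, i, serialize d ++ (serialize d ++ A), B, C, []⟩
      (14 * (serialize d).length + 9) := by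
  have hd : Γ'.blank ∉ (serialize d).reverse := by simpa using blank_notMem_serialize d
  have down₁ := lower_left hd none i A B ((serialize d).reverse ++ .blank :: C)
  have down₂ := lower_right hd (some .blank) i (serialize d ++ A) B C
  rw [List.reverse_reverse] at down₁ down₂
  refine ((Run.push _ _ _).seq ((Run.push _ _ _).seq ((lift (L := (· ++ .blank :: B))
    (R := (· ++ .blank :: C)) (fun _ _ _ _ => (Run.push _ _ _).seq (.push _ _ _)) d v A).seq
    (down₁.seq down₂)))).weaken ?_
  rw [List.length_reverse]
  lia

theorem swap (d e : BinaryTree Unit) (v : Option Γ') (i A B C : List Γ') :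
    Run swap ⟨v, i, serialize d ++ (serialize e ++ A), B, C, []⟩
      ⟨some .blank, i, serialize e ++ (serialize d ++ A), B, C, []⟩
      (10 * ((serialize d).length + (serialize e).length) + 12) := by
  have hd : Γ'.blank ∉ (serialize d).reverse := by simpa using blank_notMem_serialize d
  have he : Γ'.blank ∉ (serialize e).reverse := by simpa using blank_notMem_serialize e
  have up₁ := lift (i := i) (p := pushCur .left) (L := (· ++ .blank :: B)) (R := fun _ => C)
    (fun _ _ _ _ => .push _ _ _) d v (serialize e ++ A)
  have up₂ := lift (i := i) (p := pushCur .right)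
    (L := fun _ => (serialize d).reverse ++ .blank :: B) (R := (· ++ .blank :: C))
    (fun _ _ _ _ => .push _ _ _) e none A
  have down₁ := lower_left hd none i A B ((serialize e).reverse ++ .blank :: C)
  have down₂ := lower_right he (some .blank) i (serialize d ++ A) B C
  rw [List.reverse_reverse] at down₁ down₂
  refine ((Run.push _ _ _).seq (up₁.seq ((Run.push _ _ _).seq
    (up₂.seq (down₁.seq down₂))))).weaken ?_
  simp only [List.length_reverse]
  lia

end Run

/-! ### Functions computable in polynomial time -/

/-- Types whose elements are written on the stacks as binary trees. The encoding need not be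
injective: what it forgets is ignored by the programs. -/
class Enc (α : Type) where
  enc : α → BinaryTree Unit

namespace Enc

variable {α β : Type} [Enc α] [Enc β]

/-- The word that represents `x` on the stacks. -/
def word (x : α) : List Γ' := serialize (enc x)

instance : Enc Unit := ⟨fun _ => .nil⟩

instance : Enc (α × β) := ⟨fun x => .node () (enc x.1) (enc x.2)⟩

instance : Enc (List α) := ⟨List.foldr (fun x t => .node () (enc x) t) .nil⟩

instance : Enc Bool := ⟨fun b => bif b then enc [()] else enc ([] : List Unit)⟩

/-- The size of `x`: the length of the word that represents it. -/
def esize (x : α) : ℕ := (word x).length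

theorem esize_pair (x : α) (y : β) : esize (x, y) = esize x + esize y + 1 := by
  simp [esize, word, enc, serialize]

theorem esize_nil : esize ([] : List α) = 1 := rfl

theorem esize_cons (x : α) (l : List α) : esize (x :: l) = esize x + esize l + 1 :=
  esize_pair x l

theorem one_le_esize (x : α) : 1 ≤ esize x := by
  cases h : enc x <;> simp [esize, word, h, serialize]

theorem esize_bool_le (b : Bool) : esize b ≤ 3 := by cases b <;> decide

theorem esize_append (l₁ l₂ : List α) : esize (l₁ ++ l₂) + 1 = esize l₁ + esize l₂ := by
  induction l₁ with
  | nil => rw [List.nil_append, esize_nil, add_comm]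
  | cons x l ih => rw [List.cons_append, esize_cons, esize_cons]; lia

theorem length_lt_esize (l : List α) : l.length < esize l := by
  induction l with
  | nil => simp [esize_nil]
  | cons x l ih => rw [List.length_cons, esize_cons]; lia

theorem esize_le_of_sublist {l₁ l₂ : List α} (h : l₁.Sublist l₂) : esize l₁ ≤ esize l₂ := by
  induction h with
  | slnil => rfl
  | cons x _ ih => rw [esize_cons]; lia
  | cons_cons x _ ih => rw [esize_cons, esize_cons]; lia

theorem esize_lt_of_mem {x : α} {l : List α} (h : x ∈ l) : esize x < esize l := by
  have := esize_le_of_sublist (List.singleton_sublist.2 h)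
  rw [esize_cons, esize_nil] at this
  lia

theorem esize_le_of_forall_mem {l : List α} {k : ℕ} (h : ∀ x ∈ l, esize x ≤ k) :
    esize l ≤ l.length * (k + 1) + 1 := by
  induction l with
  | nil => exact Nat.le_add_left _ _
  | cons x l ih =>
    have head := h x List.mem_cons_self
    have tail := ih fun y hy => h y (List.mem_cons_of_mem _ hy)
    rw [esize_cons, List.length_cons, add_mul]
    lia

theorem esize_eq_of_perm {l₁ l₂ : List α} (h : l₁.Perm l₂) : esize l₁ = esize l₂ := by
  induction h with
  | nil => rfl
  | cons x _ ih => rw [esize_cons, esize_cons, ih]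
  | swap x y l => simp only [esize_cons]; lia
  | trans _ _ ih₁ ih₂ => exact ih₁.trans ih₂

end Enc

open Enc

theorem monotone_eval_polynomial (p : Polynomial ℕ) : Monotone fun k => p.eval k := by
  intro j k h
  simp only [Polynomial.eval_eq_sum_range]
  gcongr

/-- `f` is bounded by a polynomial in the size of its argument. -/
def PolyBounded {α : Type} [Enc α] (f : α → ℕ) : Prop :=
  ∃ p : Polynomial ℕ, ∀ x, f x ≤ p.eval (esize x)

namespace PolyBounded

variable {α β : Type} [Enc α] [Enc β] {f g : α → ℕ}

theorem mono (hg : PolyBounded g) (h : ∀ x, f x ≤ g x) : PolyBounded f :=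
  hg.imp fun _ hp x => (h x).trans (hp x)

theorem const (k : ℕ) : PolyBounded fun _ : α => k := ⟨.C k, fun x => by simp⟩

theorem esize : PolyBounded fun x : α => esize x := ⟨.X, fun x => by simp⟩

theorem add (hf : PolyBounded f) (hg : PolyBounded g) : PolyBounded fun x => f x + g x := by
  obtain ⟨p, hp⟩ := hf
  obtain ⟨q, hq⟩ := hg
  exact ⟨p + q, fun x => by simpa using add_le_add (hp x) (hq x)⟩

theorem mul (hf : PolyBounded f) (hg : PolyBounded g) : PolyBounded fun x => f x * g x := by
  obtain ⟨p, hp⟩ := hf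
  obtain ⟨q, hq⟩ := hg
  exact ⟨p * q, fun x => by simpa using Nat.mul_le_mul (hp x) (hq x)⟩

theorem eval (p : Polynomial ℕ) (hf : PolyBounded f) : PolyBounded fun x => p.eval (f x) := by
  obtain ⟨q, hq⟩ := hf
  exact ⟨p.comp q, fun x => by simpa using monotone_eval_polynomial p (hq x)⟩

theorem comp {g : β → ℕ} (hg : PolyBounded g) {f : α → β}
    (hf : PolyBounded fun x => Enc.esize (f x)) : PolyBounded fun x => g (f x) := by
  obtain ⟨p, hp⟩ := hg
  exact (hf.eval p).mono fun x => hp (f x)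

end PolyBounded

/-- In at most `k` steps, `P` replaces the word `u` on top of the main stack by `w`, whatever lies
below it. -/
def Transforms (P : Prog) (u w : List Γ') (k : ℕ) : Prop :=
  ∀ (v : Option Γ') (i A B C : List Γ'),
    ∃ v', Run P ⟨v, i, u ++ A, B, C, []⟩ ⟨v', i, w ++ A, B, C, []⟩ k

namespace Transforms

variable {P Q : Prog} {u v w : List Γ'} {j k : ℕ}

theorem seq (hP : Transforms P u v j) (hQ : Transforms Q v w k) :
    Transforms (P ;; Q) u w (j + k) := fun c i A B C => by
  obtain ⟨c₁, h₁⟩ := hP c i A B C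
  obtain ⟨c₂, h₂⟩ := hQ c₁ i A B C
  exact ⟨c₂, h₁.seq h₂⟩

theorem append (h : Transforms P u w k) (r : List Γ') : Transforms P (u ++ r) (w ++ r) k :=
  fun c i A B C => by simpa only [List.append_assoc] using h c i (r ++ A) B C

theorem weaken (h : Transforms P u w j) (hjk : j ≤ k) : Transforms P u w k :=
  fun c i A B C => (h c i A B C).imp fun _ h => h.weaken hjk

end Transforms

/-- For all `x`, `P` replaces the word `u x` on top of the main stack by `w x` in time polynomial in
the size of `x`. -/
def PolyTransforms {α : Type} [Enc α] (P : Prog) (u w : α → List Γ') : Prop :=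
  ∃ p : Polynomial ℕ, ∀ x, Transforms P (u x) (w x) (p.eval (esize x))

namespace PolyTransforms

variable {α β γ : Type} [Enc α] [Enc β] [Enc γ] {P Q : Prog} {u v w : α → List Γ'}

theorem of_bounded {k : α → ℕ} (hk : PolyBounded k) (h : ∀ x, Transforms P (u x) (w x) (k x)) :
    PolyTransforms P u w :=
  hk.imp fun _ hp x => (h x).weaken (hp x)

theorem seq (hP : PolyTransforms P u v) (hQ : PolyTransforms Q v w) :
    PolyTransforms (P ;; Q) u w := by
  obtain ⟨p, hp⟩ := hP
  obtain ⟨q, hq⟩ := hQ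
  exact ⟨p + q, fun x => by simpa using (hp x).seq (hq x)⟩

theorem append (h : PolyTransforms P u w) (r : α → List Γ') :
    PolyTransforms P (fun x => u x ++ r x) (fun x => w x ++ r x) :=
  h.imp fun _ hp x => (hp x).append (r x)

theorem comp (h : PolyTransforms P u w) {f : β → α} (hf : PolyBounded fun x => esize (f x)) :
    PolyTransforms P (fun x => u (f x)) (fun x => w (f x)) := by
  obtain ⟨p, hp⟩ := h
  exact of_bounded (hf.eval p) fun x => hp (f x)

theorem skip (u : α → List Γ') : PolyTransforms .skip u u :=
  of_bounded (.const 1) fun _ c _ _ _ _ => ⟨c, .skip _⟩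

theorem pushWord (w : List Γ') (u : α → List Γ') :
    PolyTransforms (.pushWord w) u fun x => w ++ u x :=
  of_bounded (.const (w.length + 1)) fun _ c _ _ _ _ =>
    ⟨c, by simpa only [List.append_assoc] using Run.pushWord _ _ _ _ _ _ _⟩

theorem pop (y : α → Γ') (u : α → List Γ') : PolyTransforms (.pop .main) (fun x => y x :: u x) u :=
  of_bounded (.const 1) fun x _ _ _ _ _ => ⟨some (y x), .pop _ _⟩

theorem dup {f : α → β} (hf : PolyBounded fun x => esize (f x)) :
    PolyTransforms .dup (fun x => word (f x)) fun x => word (f x) ++ word (f x) :=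
  of_bounded (((PolyBounded.const 14).mul hf).add (.const 9)) fun _ _ _ _ _ _ =>
    ⟨_, by simpa only [List.append_assoc, word, esize] using Run.dup (enc _) _ _ _ _ _⟩

theorem drop {f : α → β} (hf : PolyBounded fun x => esize (f x)) (u : α → List Γ') :
    PolyTransforms .drop (fun x => word (f x) ++ u x) u :=
  of_bounded (((PolyBounded.const 7).mul hf).add (.const 3)) fun _ _ _ _ _ _ =>
    ⟨_, by simpa only [List.append_assoc, word, esize] using Run.drop (enc _) _ _ _ _ _⟩

theorem swap {f : α → β} {g : α → γ} (hf : PolyBounded fun x => esize (f x))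
    (hg : PolyBounded fun x => esize (g x)) :
    PolyTransforms .swap (fun x => word (f x) ++ word (g x)) fun x => word (g x) ++ word (f x) :=
  of_bounded (((PolyBounded.const 10).mul (hf.add hg)).add (.const 12)) fun _ _ _ _ _ _ =>
    ⟨_, by simpa only [List.append_assoc, word, esize] using Run.swap (enc _) (enc _) _ _ _ _ _⟩

end PolyTransforms

/-- `f` is computed by a stack program in polynomial time. The bound on the size of the result is
part of the definition because a running time of a program does not mention sizes. -/
structure PolyTime {α β : Type} [Enc α] [Enc β] (f : α → β) : Prop where
  polyBounded_esize : PolyBounded fun x => esize (f x)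
  exists_polyTransforms : ∃ P, PolyTransforms P (fun x => word x) fun x => word (f x)

namespace PolyTime

variable {α β γ : Type} [Enc α] [Enc β] [Enc γ]

protected theorem id : PolyTime fun x : α => x := ⟨.esize, .skip, .skip _⟩

theorem comp {g : β → γ} {f : α → β} (hg : PolyTime g) (hf : PolyTime f) :
    PolyTime fun x => g (f x) := by
  obtain ⟨sg, Q, hQ⟩ := hg
  obtain ⟨sf, P, hP⟩ := hf
  exact ⟨sg.comp sf, P ;; Q, hP.seq (hQ.comp sf)⟩

theorem of_enc_eq {f : α → β} {g : α → γ} (hf : PolyTime f) (h : ∀ x, enc (f x) = enc (g x)) :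
    PolyTime g := by
  have word_eq (x : α) : word (f x) = word (g x) := congrArg serialize (h x)
  obtain ⟨hsize, P, hP⟩ := hf
  simp only [esize, word_eq] at hsize hP
  exact ⟨hsize, P, hP⟩

theorem const (b : β) : PolyTime fun _ : α => b :=
  ⟨.const _, .drop ;; .pushWord (word b), by
    have drop := PolyTransforms.drop (PolyBounded.esize (α := α)) fun _ => []
    have push := PolyTransforms.pushWord (word b) fun _ : α => []
    simpa only [List.append_nil] using drop.seq push⟩

theorem pair {f : α → β} {g : α → γ} (hf : PolyTime f) (hg : PolyTime g) :
    PolyTime fun x => (f x, g x) := by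
  obtain ⟨sf, P, hP⟩ := hf
  obtain ⟨sg, Q, hQ⟩ := hg
  refine ⟨((sf.add sg).add (.const 1)).mono fun x => (esize_pair _ _).le,
    .dup ;; P ;; .swap ;; Q ;; .swap ;; .pushWord [.bra], ?_⟩
  exact (PolyTransforms.dup .esize).seq ((hP.append _).seq ((PolyTransforms.swap sf .esize).seq
    ((hQ.append _).seq ((PolyTransforms.swap sg sf).seq (.pushWord [.bra] _)))))

theorem fst : PolyTime (Prod.fst : α × β → α) := by
  have size₁ : PolyBounded fun x : α × β => esize x.1 :=
    PolyBounded.esize.mono fun ⟨_, _⟩ => by rw [esize_pair]; lia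
  have size₂ : PolyBounded fun x : α × β => esize x.2 :=
    PolyBounded.esize.mono fun ⟨_, _⟩ => by rw [esize_pair]; lia
  exact ⟨size₁, .pop .main ;; .swap ;; .drop, (PolyTransforms.pop (fun _ => .bra) _).seq
    ((PolyTransforms.swap size₁ size₂).seq (.drop size₂ _))⟩

theorem snd : PolyTime (Prod.snd : α × β → β) := by
  have size₁ : PolyBounded fun x : α × β => esize x.1 := fst.1
  have size₂ : PolyBounded fun x : α × β => esize x.2 :=
    PolyBounded.esize.mono fun ⟨_, _⟩ => by rw [esize_pair]; lia
  exact ⟨size₂, .pop .main ;; .drop, (PolyTransforms.pop (fun _ => .bra) _).seq (.drop size₁ _)⟩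

end PolyTime

namespace PolyTime

variable {α β : Type} [Enc α] [Enc β]

theorem nil : PolyTime fun _ : α => ([] : List β) := const []

theorem cons {f : α → β} {l : α → List β} (hf : PolyTime f) (hl : PolyTime l) :
    PolyTime fun x => f x :: l x :=
  (hf.pair hl).of_enc_eq fun _ => rfl

end PolyTime

namespace Prog

/-- Remove the two topmost symbols of the main stack. -/
def pop₂ : Prog := pop .main ;; pop .main

/-- Run `P` on a pair whose first component is a nonempty list, and `Q` on the second component of a
pair whose first component is the empty list. -/
def listCases (P Q : Prog) : Prog :=
  pop₂ ;; cond (· == some .bra) (pushWord [.bra, .bra] ;; P) Q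

/-- Replace a list and a state by the result of a left fold, where `P` replaces an entry, the
remaining list and a state by the remaining list and the next state. -/
def foldl (P : Prog) : Prog :=
  pop₂ ;; loop (· == some .bra) (pushWord [.bra, .bra] ;; P ;; pop₂)

end Prog

theorem Run.pop₂ (v : Option Γ') (i A B C N : List Γ') :
    Run .pop₂ ⟨v, i, A, B, C, N⟩ ⟨A.tail.head?, i, A.tail.tail, B, C, N⟩ 2 :=
  (Run.pop _ _).seq (.pop _ _)

-- In the next two proofs, `((b, t), x)` is represented by the same word as `(b :: t, x)`.
theorem Transforms.listCases {α β : Type} [Enc α] [Enc β] {P Q : Prog} {w : List Γ'} {k : ℕ}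
    (l : List β) (x : α) (hnil : l = [] → Transforms Q (word x) w k)
    (hcons : ∀ b t, l = b :: t → Transforms P (word ((b, t), x)) w k) :
    Transforms (.listCases P Q) (word (l, x)) w (k + 6) := fun v i A B C => by
  rcases l with _ | ⟨b, t⟩
  · obtain ⟨v', branch⟩ := hnil rfl (some .ket) i A B C
    exact ⟨v', ((Run.pop₂ v i _ B C []).seq (.cond_false rfl branch)).weaken (by lia)⟩
  · obtain ⟨v', branch⟩ := hcons b t rfl (some .bra) i A B C
    refine ⟨v', ((Run.pop₂ v i _ B C []).seq
      (.cond_true rfl ((Run.pushWord [.bra, .bra] _ _ _ _ _ _).seq branch))).weaken ?_⟩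
    simp only [List.length_cons, List.length_nil]
    lia

theorem Transforms.foldl {β σ : Type} [Enc β] [Enc σ] {step : σ → β → σ} {P : Prog} {k : ℕ}
    (l : List β) {s : σ}
    (hP : ∀ l₁ b l₂, l = l₁ ++ b :: l₂ → Transforms P (word ((b, l₂), l₁.foldl step s))
      (word (l₂, step (l₁.foldl step s) b)) k) :
    Transforms (.foldl P) (word (l, s)) (word (l.foldl step s)) (l.length * (k + 6) + 3) := by
  suffices loop : ∀ i A B C, Run (.loop (· == some .bra) (.pushWord [.bra, .bra] ;; P ;; .pop₂))
      ⟨(word (l, s) ++ A).tail.head?, i, (word (l, s) ++ A).tail.tail, B, C, []⟩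
      ⟨some .ket, i, word (l.foldl step s) ++ A, B, C, []⟩ (l.length * (k + 6) + 1) from
    fun v i A B C => ⟨_, ((Run.pop₂ v i _ B C []).seq (loop i A B C)).weaken (by lia)⟩
  induction l generalizing s with
  | nil =>
    exact fun i A B C => (Run.loop_done (s := ⟨some .ket, i, word s ++ A, B, C, []⟩) rfl).weaken
      (Nat.le_add_left _ _)
  | cons b t ih =>
    intro i A B C
    obtain ⟨v, body⟩ := hP [] b t rfl (some .bra) i A B C
    have rest := ih (s := step s b) (fun l₁ c l₂ h => hP (b :: l₁) c l₂ (by rw [h]; rfl)) i A B C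
    refine (Run.loop_step rfl ((Run.pushWord [.bra, .bra] _ _ _ _ _ _).seq
      (body.seq (.pop₂ v i _ B C []))) rest).weaken ?_
    simp only [List.length_cons, List.length_nil]
    lia

namespace PolyTime

variable {α β γ σ : Type} [Enc α] [Enc β] [Enc γ] [Enc σ]

theorem listCases {f : List β × α → γ} (hnil : PolyTime fun x => f ([], x))
    (hcons : PolyTime fun y : (β × List β) × α => f (y.1.1 :: y.1.2, y.2)) : PolyTime f := by
  obtain ⟨⟨p, hp⟩, Q, q, hQ⟩ := hnil
  obtain ⟨⟨p', hp'⟩, P, q', hP⟩ := hcons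
  have esize_le (x : α) : esize x ≤ esize (([] : List β), x) := by rw [esize_pair]; lia
  refine ⟨⟨p + p', ?_⟩, .listCases P Q, q + q' + 6, fun ⟨l, x⟩ => ?_⟩
  · rintro ⟨_ | ⟨b, t⟩, x⟩ <;> rw [Polynomial.eval_add]
    · exact (hp x).trans ((monotone_eval_polynomial p (esize_le x)).trans (Nat.le_add_right _ _))
    · exact (hp' ((b, t), x)).trans (Nat.le_add_left _ _)
  · refine (Transforms.listCases l x (k := q.eval (esize (l, x)) + q'.eval (esize (l, x))) ?_
      ?_).weaken (by simp)
    · rintro rfl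
      exact (hQ x).weaken ((monotone_eval_polynomial q (esize_le x)).trans (Nat.le_add_right _ _))
    · rintro b t rfl
      exact (hP ((b, t), x)).weaken (Nat.le_add_left _ _)

theorem cond {c : α → Bool} {f g : α → β} (hc : PolyTime c) (hf : PolyTime f) (hg : PolyTime g) :
    PolyTime fun x => bif c x then f x else g x := by
  have asList : PolyTime fun x => bif c x then [()] else [] :=
    hc.of_enc_eq fun x => by cases h : c x <;> rfl
  have cases : PolyTime fun y : List Unit × α => bif y.1.isEmpty then g y.2 else f y.2 :=
    listCases hg (hf.comp snd)
  convert cases.comp (asList.pair .id) using 2 with x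
  cases c x <;> rfl

theorem foldl {step : σ → β → σ} {l : α → List β} {s : α → σ} {B : α → ℕ}
    (hstep : PolyTime fun y : σ × β => step y.1 y.2) (hl : PolyTime l) (hs : PolyTime s)
    (hB : PolyBounded B) (hsize : ∀ x l₁, l₁ <+: l x → esize (l₁.foldl step (s x)) ≤ B x) :
    PolyTime fun x => (l x).foldl step (s x) := by
  obtain ⟨-, P, p, hP⟩ : PolyTime fun y : (β × List β) × σ => (y.1.2, step y.2 y.1.1) :=
    (snd.comp fst).pair (hstep.comp (snd.pair (fst.comp fst)))
  have size_args : PolyBounded fun x => esize (l x) + B x + 1 :=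
    (hl.polyBounded_esize.add hB).add (.const 1)
  have fold : PolyTransforms (.foldl P) (fun x => word (l x, s x))
      fun x => word ((l x).foldl step (s x)) := by
    have time : PolyBounded fun x => esize (l x) * (p.eval (esize (l x) + B x + 1) + 6) + 3 :=
      (hl.polyBounded_esize.mul ((size_args.eval p).add (.const 6))).add (.const 3)
    refine .of_bounded time fun x =>
      (Transforms.foldl (k := p.eval (esize (l x) + B x + 1)) (l x) fun l₁ b l₂ h =>
        (hP _).weaken (monotone_eval_polynomial p ?_)).weaken ?_
    · have suffix_le : esize (b :: l₂) ≤ esize (l x) :=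
        esize_le_of_sublist (h ▸ List.sublist_append_right _ _)
      have state_le := hsize x l₁ (h ▸ List.prefix_append _ _)
      rw [esize_cons] at suffix_le
      rw [esize_pair, esize_pair]
      lia
    · gcongr
      exact (length_lt_esize _).le
  obtain ⟨-, Q, hQ⟩ := hl.pair hs
  exact ⟨hB.mono fun x => hsize x _ List.prefix_rfl, Q ;; .foldl P, hQ.seq fold⟩

theorem iterate {F : σ → σ} {C : ℕ} (hF : PolyTime F) (hsize : ∀ s, esize (F s) ≤ esize s + C)
    {l : α → List β} {s : α → σ} (hl : PolyTime l) (hs : PolyTime s) :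
    PolyTime fun x => F^[(l x).length] (s x) := by
  have esize_iterate (k : ℕ) (s : σ) : esize (F^[k] s) ≤ esize s + k * C := by
    induction k with
    | zero => simp
    | succ k ih =>
      rw [Function.iterate_succ_apply', add_mul, one_mul, ← add_assoc]
      exact (hsize _).trans (Nat.add_le_add_right ih C)
  simpa only [List.foldl_const] using foldl (step := fun s _ => F s) (hF.comp fst) hl hs
    (hs.polyBounded_esize.add (hl.polyBounded_esize.mul (.const C))) fun x l₁ h => by
      rw [List.foldl_const]
      refine (esize_iterate _ _).trans ?_
      gcongr
      exact h.length_le.trans (length_lt_esize _).le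

theorem reverse : PolyTime (List.reverse : List β → List β) := by
  have foldl_cons (l : List β) : l.foldl (fun r b => b :: r) [] = l.reverse := by simp
  simpa only [foldl_cons] using foldl (step := fun (r : List β) b => b :: r) (snd.cons fst) .id
    nil .esize fun l l₁ h => by
      rw [foldl_cons, esize_eq_of_perm (List.reverse_perm _)]
      exact esize_le_of_sublist h.sublist

-- The recursion is run as a left fold over the reversed list, which also rebuilds the list.
theorem listRec {f : α → List β → γ} {g : α × β × List β × γ → γ}
    (hnil : PolyTime fun x => f x []) (hcons : PolyTime g)
    (hf : ∀ x b t, f x (b :: t) = g (x, b, t, f x t))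
    (hsize : PolyBounded fun y : α × List β => esize (f y.1 y.2)) :
    PolyTime fun y : α × List β => f y.1 y.2 := by
  obtain ⟨p, hp⟩ := hsize
  let step (s : α × List β × γ) (b : β) : α × List β × γ := (s.1, b :: s.2.1, g (s.1, b, s.2))
  have foldl_step (x : α) (l : List β) :
      l.foldl step (x, [], f x []) = (x, l.reverse, f x l.reverse) := by
    induction l using List.reverseRecOn with
    | nil => rfl
    | append_singleton l b ih => simp [ih, step, hf]
  have hstep : PolyTime fun y : (α × List β × γ) × β => step y.1 y.2 :=
    (fst.comp fst).pair ((snd.cons (fst.comp (snd.comp fst))).pair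
      (hcons.comp ((fst.comp fst).pair (snd.pair (snd.comp fst)))))
  have fold : PolyTime fun y : α × List β => y.2.reverse.foldl step (y.1, [], f y.1 []) := by
    refine foldl hstep (reverse.comp snd) (fst.pair (nil.pair (hnil.comp fst)))
      ((PolyBounded.esize.add (.eval p .esize)).add (.const 1)) fun ⟨x, l⟩ l₁ h => ?_
    have suffix_le : esize l₁.reverse ≤ esize l := by
      rw [esize_eq_of_perm (List.reverse_perm _), ← esize_eq_of_perm (List.reverse_perm l)]
      exact esize_le_of_sublist h.sublist
    have value_le := (hp (x, l₁.reverse)).trans (monotone_eval_polynomial p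
      (show esize (x, l₁.reverse) ≤ esize (x, l) by rw [esize_pair, esize_pair]; lia))
    rw [foldl_step, esize_pair, esize_pair, esize_pair x l]
    rw [esize_pair x l] at value_le
    lia
  simpa only [foldl_step, List.reverse_reverse] using snd.comp (snd.comp fold)

theorem not {c : α → Bool} (hc : PolyTime c) : PolyTime fun x => !c x := by
  convert hc.cond (const false) (const true) using 2 with x
  cases c x <;> rfl

theorem and {c d : α → Bool} (hc : PolyTime c) (hd : PolyTime d) :
    PolyTime fun x => c x && d x := by
  convert hc.cond hd (const false) using 2 with x
  cases c x <;> rfl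

theorem or {c d : α → Bool} (hc : PolyTime c) (hd : PolyTime d) :
    PolyTime fun x => c x || d x := by
  convert hc.cond (const true) hd using 2 with x
  cases c x <;> rfl

theorem xor {c d : α → Bool} (hc : PolyTime c) (hd : PolyTime d) :
    PolyTime fun x => c x ^^ d x := by
  convert hc.cond hd.not hd using 2 with x
  cases c x <;> simp

theorem append : PolyTime fun y : List β × List β => y.1 ++ y.2 := by
  refine (listRec (f := fun m l : List β => l ++ m) (g := fun y => y.2.1 :: y.2.2.2) .id
    ((fst.comp snd).cons (snd.comp (snd.comp snd))) (fun _ _ _ => rfl)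
    (PolyBounded.esize.mono fun ⟨m, l⟩ => ?_)).comp (snd.pair fst)
  have := esize_append l m
  rw [esize_pair]
  lia

theorem any {p : α → β → Bool} {l : α → List β} (hp : PolyTime fun y : α × β => p y.1 y.2)
    (hl : PolyTime l) : PolyTime fun x => (l x).any (p x) :=
  (listRec (f := fun x l => l.any (p x)) (g := fun y => p y.1 y.2.1 || y.2.2.2) (const false)
    ((hp.comp (fst.pair (fst.comp snd))).or (snd.comp (snd.comp snd))) (fun _ _ _ => rfl)
    ((PolyBounded.const 3).mono fun _ => esize_bool_le _)).comp (.pair .id hl)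

theorem map {f : α → β} (hf : PolyTime f) : PolyTime (List.map f) := by
  obtain ⟨p, hp⟩ := hf.polyBounded_esize
  refine (listRec (f := fun (_ : Unit) l => l.map f) (g := fun y => f y.2.1 :: y.2.2.2) nil
    ((hf.comp (fst.comp snd)).cons (snd.comp (snd.comp snd))) (fun _ _ _ => rfl)
    (((PolyBounded.esize.mul ((PolyBounded.esize.eval p).add (.const 1))).add (.const 1)).mono
      fun ⟨_, l⟩ => ?_)).comp ((const ()).pair .id)
  have map_le : ∀ y ∈ l.map f, esize y ≤ p.eval (esize l) := by
    simp only [List.forall_mem_map]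
    exact fun x hx => (hp x).trans (monotone_eval_polynomial p (esize_lt_of_mem hx).le)
  refine (esize_le_of_forall_mem map_le).trans ?_
  have := length_lt_esize l
  have := monotone_eval_polynomial p (show esize l ≤ esize ((), l) by rw [esize_pair]; lia)
  rw [List.length_map]
  gcongr
  rw [esize_pair]
  lia

theorem filter {p : α → β → Bool} {l : α → List β} (hp : PolyTime fun y : α × β => p y.1 y.2)
    (hl : PolyTime l) : PolyTime fun x => (l x).filter (p x) :=
  (listRec (f := fun x l => l.filter (p x))
    (g := fun y => bif p y.1 y.2.1 then y.2.1 :: y.2.2.2 else y.2.2.2) nil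
    ((hp.comp (fst.pair (fst.comp snd))).cond
      ((fst.comp snd).cons (snd.comp (snd.comp snd))) (snd.comp (snd.comp snd)))
    (fun x b t => by rw [List.filter_cons, cond_eq_ite])
    (PolyBounded.esize.mono fun ⟨x, l⟩ => (esize_le_of_sublist List.filter_sublist).trans
      (by rw [esize_pair]; lia))).comp (.pair .id hl)

theorem insertionSort {r : β → β → Bool} (hr : PolyTime fun y : β × β => r y.1 y.2) :
    PolyTime fun l : List β => l.insertionSort fun a b => r a b := by
  have esize_insert (a : β) (l : List β) :
      esize (l.orderedInsert (fun a b => r a b) a) = esize (a :: l) :=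
    esize_eq_of_perm (List.perm_orderedInsert _ a l)
  have insert : PolyTime fun y : β × List β => y.2.orderedInsert (fun a b => r a b) y.1 :=
    listRec (f := fun a l => l.orderedInsert (fun a b => r a b) a)
      (g := fun y => bif r y.1 y.2.1 then y.1 :: y.2.1 :: y.2.2.1 else y.2.1 :: y.2.2.2)
      (PolyTime.id.cons nil)
      ((hr.comp (fst.pair (fst.comp snd))).cond
        (fst.cons ((fst.comp snd).cons (fst.comp (snd.comp snd))))
        ((fst.comp snd).cons (snd.comp (snd.comp snd))))
      (fun a b t => by rw [List.orderedInsert, cond_eq_ite])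
      (PolyBounded.esize.mono fun ⟨a, l⟩ => by rw [esize_insert]; rfl)
  refine (listRec (f := fun (_ : Unit) l => l.insertionSort fun a b => r a b)
    (g := fun y => y.2.2.2.orderedInsert (fun a b => r a b) y.2.1) nil
    (insert.comp ((fst.comp snd).pair (snd.comp (snd.comp snd)))) (fun _ _ _ => rfl)
    (PolyBounded.esize.mono fun ⟨_, l⟩ => ?_)).comp ((const ()).pair .id)
  rw [esize_eq_of_perm (List.perm_insertionSort _ l), esize_pair]
  lia

end PolyTime

/-! ### Binary arithmetic -/

instance : Enc ℕ := ⟨fun k => enc k.bits⟩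

theorem foldr_bit_bits (k : ℕ) : k.bits.foldr Nat.bit 0 = k := by
  induction k using Nat.binaryRec' with
  | zero => simp
  | bit b k h ih => rw [Nat.bits_append_bit k b h, List.foldr_cons, ih]

theorem size_add_le (a b : ℕ) : (a + b).size ≤ max a.size b.size + 1 := by
  rw [Nat.size_le, pow_succ]
  have ha := (Nat.lt_size_self a).trans_le (Nat.pow_le_pow_right two_pos (le_max_left _ b.size))
  have hb := (Nat.lt_size_self b).trans_le (Nat.pow_le_pow_right two_pos (le_max_right a.size _))
  lia

theorem size_bit_le (b : Bool) (k : ℕ) : (Nat.bit b k).size ≤ k.size + 1 := by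
  have := Nat.lt_size_self k
  have := b.toNat_le
  rw [Nat.size_le, Nat.bit_val, pow_succ]
  lia

theorem size_foldl_bit_le (l : List Bool) (k : ℕ) :
    (l.foldl (fun k d => Nat.bit d k) k).size ≤ k.size + l.length := by
  induction l generalizing k with
  | nil => rfl
  | cons d l ih =>
    have := size_bit_le d k
    refine (ih _).trans ?_
    rw [List.length_cons]
    lia

theorem size_foldr_bit_le (l : List Bool) : (l.foldr Nat.bit 0).size ≤ l.length := by
  induction l with
  | nil => simp
  | cons d l ih => exact (size_bit_le _ _).trans (Nat.add_le_add_right ih 1)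

theorem size_mul_le (a b : ℕ) : (a * b).size ≤ a.size + b.size := by
  rw [Nat.size_le, pow_add]
  exact Nat.mul_lt_mul'' (Nat.lt_size_self a) (Nat.lt_size_self b)

namespace Enc

theorem size_lt_esize (k : ℕ) : k.size < esize k :=
  Nat.size_eq_bits_len k ▸ length_lt_esize k.bits

theorem esize_le_of_nat (k : ℕ) : esize k ≤ 4 * k.size + 1 :=
  Nat.size_eq_bits_len k ▸ mul_comm _ 4 ▸ esize_le_of_forall_mem fun b _ => esize_bool_le b

theorem esize_div2_le (k : ℕ) : esize k.div2 ≤ esize k := by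
  change esize k.div2.bits ≤ esize k.bits
  rw [Nat.div2_bits_eq_tail]
  exact esize_le_of_sublist (List.tail_sublist _)

end Enc

section halveStep

variable {σ γ : Type} {step : σ → Bool → Bool → σ}

/-- Halve two numbers and update the state `s.2` by their last binary digits. -/
def halveStep (step : σ → Bool → Bool → σ) (s : (ℕ × ℕ) × σ) : (ℕ × ℕ) × σ :=
  ((s.1.1.div2, s.1.2.div2), step s.2 s.1.1.bodd s.1.2.bodd)

/-- Update a state by the binary digits of two numbers, from the least significant digits on. -/
def foldBits (step : σ → Bool → Bool → σ) (s : σ) (a b : ℕ) : σ :=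
  ((halveStep step)^[(a.bits ++ b.bits).length] ((a, b), s)).2

theorem iterate_halveStep_fst (k a b : ℕ) (s : σ) :
    ((halveStep step)^[k] ((a, b), s)).1 = (Nat.div2^[k] a, Nat.div2^[k] b) := by
  induction k generalizing a b s with
  | zero => rfl
  | succ _ ih => exact ih _ _ _

theorem iterate_div2_eq_zero {k a : ℕ} (h : a.bits.length ≤ k) : Nat.div2^[k] a = 0 := by
  have bits_iterate (j : ℕ) : (Nat.div2^[j] a).bits = a.bits.drop j := by
    rw [← List.tail_iterate]
    exact Function.Semiconj.iterate_right (f := Nat.bits) Nat.div2_bits_eq_tail j a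
  rw [← foldr_bit_bits (Nat.div2^[k] a), bits_iterate, List.drop_eq_nil_of_le h, List.foldr_nil]

theorem foldBits_invariant {V : ℕ → ℕ → σ → γ}
    (hV : ∀ a b s, V a.div2 b.div2 (step s a.bodd b.bodd) = V a b s) (s : σ) (a b : ℕ) :
    V 0 0 (foldBits step s a b) = V a b s := by
  have invariant (k : ℕ) : ∀ t : (ℕ × ℕ) × σ,
      V ((halveStep step)^[k] t).1.1 ((halveStep step)^[k] t).1.2 ((halveStep step)^[k] t).2 =
        V t.1.1 t.1.2 t.2 := by
    induction k with
    | zero => exact fun _ => rfl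
    | succ k ih => exact fun t => (ih _).trans (hV _ _ _)
  have := invariant (a.bits ++ b.bits).length ((a, b), s)
  rwa [iterate_halveStep_fst, iterate_div2_eq_zero (by simp),
    iterate_div2_eq_zero (by simp)] at this

end halveStep

/-- The state consists of the carry and the digits of the sum so far, the last one first. -/
def addStep (s : Bool × List Bool) (a b : Bool) : Bool × List Bool :=
  (bif a then b || s.1 else b && s.1, ((a ^^ b) ^^ s.1) :: s.2)

/-- The state is the comparison of the digits so far; the next digits decide unless they agree. -/
def leStep (s a b : Bool) : Bool := bif a ^^ b then b else s

theorem foldBits_addStep (a b : ℕ) :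
    (foldBits addStep (false, []) a b).2.foldl (fun k d => Nat.bit d k)
      (foldBits addStep (false, []) a b).1.toNat = a + b := by
  have := foldBits_invariant (step := addStep)
    (V := fun a b s => s.2.foldl (fun k d => Nat.bit d k) (a + b + s.1.toNat)) (fun a b s => ?_)
    (false, []) a b
  · simpa using this
  · have ha := a.bodd_add_div2
    have hb := b.bodd_add_div2
    simp only [addStep, List.foldl_cons, Nat.bit_val]
    congr 1
    cases h₁ : a.bodd <;> cases h₂ : b.bodd <;> cases h₃ : s.1 <;> simp_all <;> lia

theorem foldBits_leStep (a b : ℕ) : foldBits leStep true a b = decide (a ≤ b) := by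
  have := foldBits_invariant (step := leStep) (V := fun a b s => decide (a < b ∨ a = b ∧ s))
    (fun a b s => ?_) true a b
  · simpa [← le_iff_lt_or_eq] using this
  · have ha := a.bodd_add_div2
    have hb := b.bodd_add_div2
    rw [decide_eq_decide, leStep]
    cases h₁ : a.bodd <;> cases h₂ : b.bodd <;> cases s <;> simp_all <;> lia

namespace PolyTime

variable {α β γ σ : Type} [Enc α] [Enc β] [Enc γ] [Enc σ]

theorem bits : PolyTime Nat.bits := PolyTime.id.of_enc_eq fun _ => rfl

theorem bodd : PolyTime Nat.bodd := by
  have head : PolyTime fun y : List Bool × Unit => y.1.headI :=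
    listCases (const false) (fst.comp fst)
  exact (head.comp (bits.pair (const ()))).of_enc_eq fun k =>
    congrArg enc (Nat.bodd_eq_bits_head k).symm

theorem div2 : PolyTime Nat.div2 := by
  have tail : PolyTime fun y : List Bool × Unit => y.1.tail := listCases nil (snd.comp fst)
  exact (tail.comp (bits.pair (const ()))).of_enc_eq fun k =>
    congrArg enc (Nat.div2_bits_eq_tail k).symm

theorem foldBits {step : σ → Bool → Bool → σ} {C : ℕ}
    (hstep : PolyTime fun y : σ × Bool × Bool => step y.1 y.2.1 y.2.2)
    (hsize : ∀ s a b, esize (step s a b) ≤ esize s + C) (s : σ) :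
    PolyTime fun y : ℕ × ℕ => foldBits step s y.1 y.2 := by
  have hhalve : PolyTime (halveStep step) :=
    ((div2.comp (fst.comp fst)).pair (div2.comp (snd.comp fst))).pair
      (hstep.comp (snd.pair ((bodd.comp (fst.comp fst)).pair (bodd.comp (snd.comp fst)))))
  refine snd.comp (hhalve.iterate (C := C) (fun ⟨⟨a, b⟩, s⟩ => ?_)
    (append.comp ((bits.comp fst).pair (bits.comp snd))) (PolyTime.id.pair (const s)))
  have := esize_div2_le a
  have := esize_div2_le b
  have := hsize s a.bodd b.bodd
  simp only [halveStep, esize_pair]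
  lia

theorem le : PolyTime fun y : ℕ × ℕ => decide (y.1 ≤ y.2) := by
  have hstep : PolyTime fun y : Bool × Bool × Bool => leStep y.1 y.2.1 y.2.2 :=
    ((fst.comp snd).xor (snd.comp snd)).cond (snd.comp snd) fst
  simpa only [foldBits_leStep] using hstep.foldBits (C := 3)
    (fun _ _ _ => (esize_bool_le _).trans (Nat.le_add_left _ _)) true

theorem bit {b : α → Bool} {f : α → ℕ} (hb : PolyTime b) (hf : PolyTime f) :
    PolyTime fun x => Nat.bit (b x) (f x) := by
  refine (((le.comp (hf.pair (const 0))).and hb.not).cond nil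
    (hb.cons (bits.comp hf))).of_enc_eq fun x => congrArg enc ?_
  by_cases hf : f x = 0
  · cases hb : b x <;> simp [hf]
  · simp [hf, Nat.bits_append_bit (f x) (b x) fun h => absurd h hf]

theorem add : PolyTime fun y : ℕ × ℕ => y.1 + y.2 := by
  have a : PolyTime fun y : (Bool × List Bool) × Bool × Bool => y.2.1 := fst.comp snd
  have b : PolyTime fun y : (Bool × List Bool) × Bool × Bool => y.2.2 := snd.comp snd
  have c : PolyTime fun y : (Bool × List Bool) × Bool × Bool => y.1.1 := fst.comp fst
  have hstep : PolyTime fun y : (Bool × List Bool) × Bool × Bool => addStep y.1 y.2.1 y.2.2 :=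
    (a.cond (b.or c) (b.and c)).pair (((a.xor b).xor c).cons (snd.comp fst))
  have sum := hstep.foldBits (C := 8) (fun s a b => ?_) (false, [])
  · have ofDigits : PolyTime fun s : Bool × List Bool =>
        s.2.foldl (fun k d => Nat.bit d k) s.1.toNat := by
      have carry : PolyTime Bool.toNat := PolyTime.id.cond (const 1) (const 0)
      refine (bit snd fst).foldl (step := fun k d => Nat.bit d k) snd (carry.comp fst)
        ((PolyBounded.const 4).mul .esize |>.add (.const 1)) fun s l h => ?_
      have := size_foldl_bit_le l s.1.toNat
      have carry_size : s.1.toNat.size ≤ 1 := by cases s.1 <;> simp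
      have := h.length_le.trans_lt (length_lt_esize _)
      refine (esize_le_of_nat _).trans ?_
      rw [← Prod.mk.eta (p := s), esize_pair]
      lia
    simpa only [foldBits_addStep] using ofDigits.comp sum
  · have := one_le_esize s.1
    have := esize_bool_le (bif a then b || s.1 else b && s.1)
    have := esize_bool_le ((a ^^ b) ^^ s.1)
    rw [← Prod.mk.eta (p := s), esize_pair, addStep, esize_pair, esize_cons]
    lia

theorem mul : PolyTime fun y : ℕ × ℕ => y.1 * y.2 := by
  have product : PolyTime fun y : ℕ × List Bool => y.2.foldr Nat.bit 0 * y.1 := by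
    refine listRec (f := fun b (l : List Bool) => l.foldr Nat.bit 0 * b)
      (g := fun y => (bif y.2.1 then y.1 else 0) + Nat.bit false y.2.2.2)
      (by simpa using const 0)
      (add.comp (((fst.comp snd).cond fst (const 0)).pair
        (bit (const false) (snd.comp (snd.comp snd)))))
      (fun b d t => ?_)
      (((PolyBounded.const 4).mul .esize).add (.const 1) |>.mono fun ⟨b, l⟩ => ?_)
    · rw [List.foldr_cons, Nat.bit_val, Nat.bit_val, add_mul, add_comm]
      cases d <;> simp [mul_assoc]
    · have := size_mul_le (l.foldr Nat.bit 0) b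
      have := size_foldr_bit_le l
      have := length_lt_esize l
      have := size_lt_esize b
      refine (esize_le_of_nat _).trans ?_
      rw [esize_pair]
      lia
  simpa only [foldr_bit_bits] using product.comp (snd.pair (bits.comp fst))

end PolyTime

/-! ### Fractions -/

instance : Enc ℕ+ := ⟨fun k => enc (k : ℕ)⟩

/-- A nonnegative rational number as numerator and denominator. Fractions are never reduced to
lowest terms, so that arithmetic needs no greatest common divisors. -/
abbrev Frac := ℕ × ℕ+

namespace Frac

variable {p q : Frac}

/-- The number that a fraction stands for. -/
noncomputable def val (p : Frac) : ℝ := p.1 / p.2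

/-- Comparison by cross-multiplication. -/
def le (p q : Frac) : Bool := decide (p.1 * (q.2 : ℕ) ≤ q.1 * (p.2 : ℕ))

/-- The sum over the product of the denominators. -/
def add (p q : Frac) : Frac := (p.1 * (q.2 : ℕ) + q.1 * (p.2 : ℕ), p.2 * q.2)

/-- The product, componentwise. -/
def mul (p q : Frac) : Frac := (p.1 * q.1, p.2 * q.2)

/-- The number of binary digits of the larger one of numerator and denominator. -/
def digits (p : Frac) : ℕ := max p.1.size (p.2 : ℕ).size

/-- A nonnegative rational number in lowest terms. -/
def ofRat (q : ℚ) : Frac := (q.num.toNat, ⟨q.den, q.den_pos⟩)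

theorem val_nil : val (0, 1) = 0 := by simp [val]

theorem le_eq_true : le p q = true ↔ p.val ≤ q.val := by
  rw [le, decide_eq_true_iff, val, val, div_le_div_iff₀ (by positivity) (by positivity)]
  exact_mod_cast Iff.rfl

theorem val_add (p q : Frac) : (add p q).val = p.val + q.val := by
  simp only [val, add, PNat.mul_coe]
  push_cast
  field_simp

theorem val_mul (p q : Frac) : (mul p q).val = p.val * q.val := by
  simp only [val, mul, PNat.mul_coe]
  push_cast
  rw [div_mul_div_comm]

theorem val_ofRat {q : ℚ} (hq : 0 ≤ q) : (ofRat q).val = q := by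
  have num : ((q.num.toNat : ℤ) : ℚ) = q.num := by rw [Int.toNat_of_nonneg (Rat.num_nonneg.2 hq)]
  rw [val, ofRat]
  conv_rhs => rw [← q.num_div_den, ← num]
  push_cast
  rfl

theorem digits_add_le (p q : Frac) : (add p q).digits ≤ p.digits + q.digits + 1 := by
  have num := size_add_le (p.1 * q.2) (q.1 * p.2)
  have left := size_mul_le p.1 q.2
  have right := size_mul_le q.1 p.2
  have den := size_mul_le p.2 q.2
  simp only [digits, add, PNat.mul_coe]
  lia

theorem esize_le (p : Frac) : esize p ≤ 8 * p.digits + 3 := by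
  have num := esize_le_of_nat p.1
  have den := esize_le_of_nat p.2
  rw [← Prod.mk.eta (p := p), esize_pair, digits]
  change _ + esize (p.2 : ℕ) + 1 ≤ _
  lia

theorem digits_lt_esize (p : Frac) : p.digits < esize p := by
  have num := size_lt_esize p.1
  have den : (p.2 : ℕ).size < esize p.2 := size_lt_esize p.2
  rw [← Prod.mk.eta (p := p), esize_pair, digits]
  lia

end Frac

namespace PolyTime

theorem pnatVal : PolyTime PNat.val := PolyTime.id.of_enc_eq fun _ => rfl

theorem toPNat' : PolyTime Nat.toPNat' := by
  refine ((le.comp (PolyTime.id.pair (const 0))).cond (const 1) .id).of_enc_eq fun k => ?_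
  change enc _ = enc (k.toPNat' : ℕ)
  cases k <;> rfl

theorem pnatMul : PolyTime fun y : ℕ+ × ℕ+ => y.1 * y.2 :=
  (mul.comp ((pnatVal.comp fst).pair (pnatVal.comp snd))).of_enc_eq fun _ => rfl

theorem crossMul : PolyTime fun y : Frac × Frac => y.1.1 * (y.2.2 : ℕ) :=
  mul.comp ((fst.comp fst).pair (pnatVal.comp (snd.comp snd)))

theorem fracLe : PolyTime fun y : Frac × Frac => y.1.le y.2 :=
  le.comp (crossMul.pair (crossMul.comp (snd.pair fst)))

theorem fracAdd : PolyTime fun y : Frac × Frac => y.1.add y.2 :=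
  (add.comp (crossMul.pair (crossMul.comp (snd.pair fst)))).pair
    (pnatMul.comp ((snd.comp fst).pair (snd.comp snd)))

theorem fracMul : PolyTime fun y : Frac × Frac => y.1.mul y.2 :=
  (mul.comp ((fst.comp fst).pair (fst.comp snd))).pair
    (pnatMul.comp ((snd.comp fst).pair (snd.comp snd)))

end PolyTime

/-! ### The decision algorithm -/

/-- Endowment and reward level of an agent. -/
abbrev Agent := Frac × Frac

namespace Agent

/-- The sum of the endowments of agents picked greedily from the end of a list, as long as the sum
is below the threshold `τ`. -/
def greedySum (τ : Frac) : List Agent → Frac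
  | [] => (0, 1)
  | i :: l => bif τ.le (greedySum τ l) then greedySum τ l else (greedySum τ l).add i.1

/-- Whether the agent `i` demands at least as large a total contribution as `j` does, in order to
participate: `e_j / m_j ≤ e_i / m_i`. -/
def demandGE (i j : Agent) : Bool := (j.1.mul i.2).le (i.1.mul j.2)

/-- The greedy sum of the agents whose demand is at most that of `i`, heaviest first. -/
def greedySumBelow (τ : Frac) (l : List Agent) (i : Agent) : Frac :=
  greedySum τ ((l.insertionSort fun j k => j.1.le k.1).filter i.demandGE)

/-- Whether the threshold is zero or the greedy set for the demand of some agent `i` succeeds and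
meets the demand of `i`. -/
def accepts (τ : Frac) (l : List Agent) : Bool :=
  τ.le (0, 1) || l.any fun i =>
    τ.le (greedySumBelow τ l i) && i.1.le (i.2.mul (greedySumBelow τ l i))

theorem digits_greedySum_le (τ : Frac) (l : List Agent) : (greedySum τ l).digits ≤ esize l := by
  induction l with
  | nil => simp [greedySum, Frac.digits, esize_nil]
  | cons i l ih =>
    have sum := Frac.digits_add_le (greedySum τ l) i.1
    have endowment := Frac.digits_lt_esize i.1
    rw [greedySum, esize_cons, ← Prod.mk.eta (p := i), esize_pair]
    cases τ.le (greedySum τ l)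
    · exact sum.trans (by lia)
    · exact ih.trans (by lia)

end Agent

namespace PolyTime

theorem greedySum : PolyTime fun y : Frac × List Agent => Agent.greedySum y.1 y.2 := by
  have sum : PolyTime fun y : Frac × Agent × List Agent × Frac => y.2.2.2 :=
    snd.comp (snd.comp snd)
  refine listRec (f := Agent.greedySum)
    (g := fun y => bif y.1.le y.2.2.2 then y.2.2.2 else y.2.2.2.add y.2.1.1)
    (const (0, 1)) ((fracLe.comp (fst.pair sum)).cond sum
      (fracAdd.comp (sum.pair (fst.comp (fst.comp snd))))) (fun τ i l => by rw [Agent.greedySum])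
    (((PolyBounded.const 8).mul .esize).add (.const 3) |>.mono fun ⟨τ, l⟩ => ?_)
  have := Frac.esize_le (Agent.greedySum τ l)
  have := Agent.digits_greedySum_le τ l
  rw [esize_pair τ]
  lia

theorem greedySumBelow :
    PolyTime fun y : (Frac × List Agent) × Agent => Agent.greedySumBelow y.1.1 y.1.2 y.2 := by
  have sorted : PolyTime fun l : List Agent => l.insertionSort fun j k => j.1.le k.1 :=
    insertionSort (r := fun j k : Agent => j.1.le k.1)
      (fracLe.comp ((fst.comp fst).pair (fst.comp snd)))
  have demandGE : PolyTime fun y : ((Frac × List Agent) × Agent) × Agent => y.1.2.demandGE y.2 :=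
    fracLe.comp ((fracMul.comp ((fst.comp snd).pair (snd.comp (snd.comp fst)))).pair
      (fracMul.comp ((fst.comp (snd.comp fst)).pair (snd.comp snd))))
  have below : PolyTime fun y : (Frac × List Agent) × Agent =>
      (y.1.2.insertionSort fun j k => j.1.le k.1).filter y.2.demandGE :=
    demandGE.filter (sorted.comp (snd.comp fst))
  exact greedySum.comp ((fst.comp fst).pair below)

theorem accepts : PolyTime fun y : Frac × List Agent => Agent.accepts y.1 y.2 := by
  have succeeds : PolyTime fun y : (Frac × List Agent) × Agent =>
      y.1.1.le (Agent.greedySumBelow y.1.1 y.1.2 y.2) :=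
    fracLe.comp ((fst.comp fst).pair greedySumBelow)
  have accepted : PolyTime fun y : (Frac × List Agent) × Agent =>
      y.2.1.le (y.2.2.mul (Agent.greedySumBelow y.1.1 y.1.2 y.2)) :=
    fracLe.comp ((fst.comp snd).pair (fracMul.comp ((snd.comp snd).pair greedySumBelow)))
  exact (fracLe.comp (fst.pair (const (0, 1)))).or ((succeeds.and accepted).any snd)

end PolyTime

/-! ### Equilibria of balanced games -/

namespace PivotalGame

variable {n : ℕ} {G : PivotalGame n} {S P : Finset (Fin n)} {l : List (Fin n)} {i j : Fin n}

theorem contribution_insert (hi : i ∉ S) :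
    G.contribution (insert i S) = G.contribution S + G.e i := by
  rw [contribution, contribution, Finset.sum_insert hi, add_comm]

theorem contribution_erase (hi : i ∈ S) :
    G.contribution (S.erase i) = G.contribution S - G.e i := by
  rw [contribution, contribution, ← Finset.add_sum_erase S G.e hi, add_sub_cancel_left]

theorem Succeeds.mono (hS : G.Succeeds S) (h : S ⊆ P) : G.Succeeds P :=
  le_trans hS (Finset.sum_le_sum_of_subset_of_nonneg h fun i _ _ => G.e_nonneg i)

theorem IsMinimal.isCooperativeNash (hS : G.IsMinimal S)
    (h : ∀ i ∈ S, G.e i ≤ G.m i * G.contribution S) : G.IsCooperativeNash S := by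
  refine ⟨⟨fun i hi => ?_, fun i hi => ?_⟩, hS.1⟩
  · have fails : ¬G.Succeeds (S.erase i) := not_le.2 (hS.2 i hi)
    simpa [utility, hi, hS.1, fails] using h i hi
  · have succeeds := hS.1.mono (Finset.subset_insert i S)
    have := mul_le_of_le_one_left (G.e_nonneg i) (G.m_lt_one i).le
    simp only [utility, hi, hS.1, succeeds, contribution_insert hi, Finset.mem_insert_self,
      not_true_eq_false, not_false_eq_true, if_true, if_false]
    linarith

theorem IsCooperativeNash.pivotal (h : G.IsCooperativeNash S) (hi : i ∈ S) (hpos : 0 < G.e i) :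
    G.contribution (S.erase i) < G.τ ∧ G.e i ≤ G.m i * G.contribution S := by
  have stay := h.1.1 i hi
  by_cases succeeds : G.Succeeds (S.erase i)
  · simp only [utility, hi, h.2, succeeds, contribution_erase hi, Finset.notMem_erase,
      not_true_eq_false, not_false_eq_true, if_true, if_false] at stay
    have := mul_lt_of_lt_one_left hpos (G.m_lt_one i)
    linarith
  · exact ⟨not_le.1 succeeds, by simpa [utility, hi, h.2, succeeds] using stay⟩

theorem contribution_filter_pos : G.contribution {i ∈ S | 0 < G.e i} = G.contribution S :=
  Finset.sum_filter_of_ne fun i _ hi => (G.e_nonneg i).lt_of_ne' hi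

theorem IsCooperativeNash.isMinimal_filter_pos (h : G.IsCooperativeNash S) :
    G.IsMinimal {i ∈ S | 0 < G.e i} := by
  refine ⟨by rw [Succeeds, contribution_filter_pos]; exact h.2, fun j hj => ?_⟩
  obtain ⟨hjS, hpos⟩ := Finset.mem_filter.1 hj
  rw [contribution_erase hj, contribution_filter_pos, ← contribution_erase hjS]
  exact (h.pivotal hjS hpos).1

theorem IsBalanced.contribution_le (hG : G.IsBalanced) (hS : G.IsMinimal S) (hP : G.IsMinimal P)
    (h : ∀ i ∈ S \ P, ∀ j ∈ P \ S, G.e i ≤ G.e j) : G.contribution S ≤ G.contribution P := by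
  have card_eq : (S \ P).card = (P \ S).card := Finset.card_sdiff_comm (hG S P hS hP)
  have exchange : ∑ i ∈ S \ P, G.e i ≤ ∑ j ∈ P \ S, G.e j := by
    let f := Finset.equivOfCardEq card_eq
    rw [← Finset.sum_coe_sort, ← Finset.sum_coe_sort (P \ S), ← f.sum_comp]
    exact Finset.sum_le_sum fun i _ => h i i.2 (f i) (f i).2
  have split_S := Finset.sum_inter_add_sum_sdiff S P G.e
  have split_P := Finset.sum_inter_add_sum_sdiff P S G.e
  rw [Finset.inter_comm] at split_P
  rw [contribution, contribution]
  linarith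

variable (G)

open Classical in
/-- The agents picked greedily from the end of a list until they succeed. -/
noncomputable def greedySet : List (Fin n) → Finset (Fin n)
  | [] => ∅
  | i :: l => if G.Succeeds (greedySet l) then greedySet l else insert i (greedySet l)

variable {G}

theorem mem_of_mem_greedySet (h : i ∈ G.greedySet l) : i ∈ l := by
  induction l with
  | nil => simp [greedySet] at h
  | cons k l ih =>
    rw [greedySet] at h
    split_ifs at h
    · exact List.mem_cons_of_mem _ (ih h)
    · exact List.mem_cons.2 ((Finset.mem_insert.1 h).imp_right ih)

theorem isMinimal_greedySet (hnodup : l.Nodup) (hsorted : l.Pairwise fun i j => G.e i ≤ G.e j)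
    (hl : G.Succeeds (G.greedySet l)) : G.IsMinimal (G.greedySet l) := by
  induction l with
  | nil => exact ⟨hl, by simp [greedySet]⟩
  | cons k l ih =>
    obtain ⟨hk, hnodup⟩ := List.nodup_cons.1 hnodup
    obtain ⟨lightest, hsorted⟩ := List.pairwise_cons.1 hsorted
    rw [greedySet] at hl ⊢
    split_ifs at hl ⊢ with succeeds
    · exact ih hnodup hsorted succeeds
    · refine ⟨hl, fun j hj => ?_⟩
      have k_le : G.e k ≤ G.e j := by
        rcases Finset.mem_insert.1 hj with rfl | hj
        exacts [le_rfl, lightest j (mem_of_mem_greedySet hj)]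
      have := not_le.1 succeeds
      rw [contribution_erase hj, contribution_insert fun h => hk (mem_of_mem_greedySet h)]
      linarith

theorem mem_greedySet_of_not_succeeds (hl : ¬G.Succeeds (G.greedySet l)) (hi : i ∈ l) :
    i ∈ G.greedySet l := by
  induction l with
  | nil => simp at hi
  | cons k l ih =>
    rw [greedySet] at hl ⊢
    split_ifs at hl ⊢ with succeeds
    · exact absurd succeeds hl
    · exact Finset.mem_insert.2 ((List.mem_cons.1 hi).imp_right (ih succeeds))

theorem Succeeds.greedySet (hS : G.Succeeds S) (h : ∀ i ∈ S, i ∈ l) :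
    G.Succeeds (G.greedySet l) := by
  by_contra fails
  exact fails (hS.mono fun i hi => mem_greedySet_of_not_succeeds fails (h i hi))

theorem le_of_notMem_greedySet (hsorted : l.Pairwise fun i j => G.e i ≤ G.e j) (hi : i ∈ l)
    (hi' : i ∉ G.greedySet l) (hj : j ∈ G.greedySet l) : G.e i ≤ G.e j := by
  induction l with
  | nil => simp at hi
  | cons k l ih =>
    obtain ⟨lightest, hsorted⟩ := List.pairwise_cons.1 hsorted
    rw [greedySet] at hi' hj
    split_ifs at hi' hj with succeeds
    · rcases List.mem_cons.1 hi with rfl | hi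
      exacts [lightest j (mem_of_mem_greedySet hj), ih hsorted hi hi' hj]
    · exact absurd (Finset.mem_insert.2 ((List.mem_cons.1 hi).imp_right
        (mem_greedySet_of_not_succeeds succeeds))) hi'

/-- The greedy set of the agents in `l` whose demand `e_j / m_j` is at most that of `i`. -/
noncomputable def greedySetBelow (G : PivotalGame n) (l : List (Fin n)) (i : Fin n) :
    Finset (Fin n) :=
  G.greedySet (l.filter fun j => G.e j * G.m i ≤ G.e i * G.m j)

theorem isCooperativeNash_greedySetBelow (hnodup : l.Nodup)
    (hsorted : l.Pairwise fun i j => G.e i ≤ G.e j)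
    (hsucceeds : G.Succeeds (G.greedySetBelow l i))
    (hi : G.e i ≤ G.m i * G.contribution (G.greedySetBelow l i)) :
    G.IsCooperativeNash (G.greedySetBelow l i) := by
  refine (isMinimal_greedySet (hnodup.filter _) (hsorted.filter _) hsucceeds).isCooperativeNash
    fun j hj => ?_
  have demand_le : G.e j * G.m i ≤ G.e i * G.m j := by
    simpa using (List.mem_filter.1 (mem_of_mem_greedySet hj)).2
  refine le_of_mul_le_mul_right ?_ (G.m_pos i)
  calc G.e j * G.m i ≤ G.e i * G.m j := demand_le
    _ ≤ G.m i * G.contribution (G.greedySetBelow l i) * G.m j := by gcongr; exact (G.m_pos j).le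
    _ = G.m j * G.contribution (G.greedySetBelow l i) * G.m i := by ring

theorem IsCooperativeNash.exists_greedySetBelow (hS : G.IsCooperativeNash S) (hG : G.IsBalanced)
    (hτ : 0 < G.τ) (hl : ∀ i, i ∈ l) (hnodup : l.Nodup)
    (hsorted : l.Pairwise fun i j => G.e i ≤ G.e j) :
    ∃ i, G.Succeeds (G.greedySetBelow l i) ∧
      G.e i ≤ G.m i * G.contribution (G.greedySetBelow l i) := by
  let T : Finset (Fin n) := {i ∈ S | 0 < G.e i}
  have minimal : G.IsMinimal T := hS.isMinimal_filter_pos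
  have nonempty : T.Nonempty :=
    Finset.nonempty_of_sum_ne_zero (hτ.trans_le minimal.1).ne'
  obtain ⟨i, hi, hmax⟩ := T.exists_max_image (fun j => G.e j / G.m j) nonempty
  have mem_below {j : Fin n} (hj : j ∈ T) :
      j ∈ l.filter fun j => G.e j * G.m i ≤ G.e i * G.m j :=
    List.mem_filter.2 ⟨hl j, decide_eq_true
      ((div_le_div_iff₀ (G.m_pos j) (G.m_pos i)).1 (hmax j hj))⟩
  have succeeds : G.Succeeds (G.greedySetBelow l i) := minimal.1.greedySet fun _ => mem_below
  have contribution_le : G.contribution T ≤ G.contribution (G.greedySetBelow l i) :=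
    hG.contribution_le minimal
      (isMinimal_greedySet (hnodup.filter _) (hsorted.filter _) succeeds) fun j hj k hk =>
        le_of_notMem_greedySet (hsorted.filter _) (mem_below (Finset.mem_sdiff.1 hj).1)
          (Finset.mem_sdiff.1 hj).2 (Finset.mem_sdiff.1 hk).1
  obtain ⟨hiS, hpos⟩ := Finset.mem_filter.1 hi
  refine ⟨i, succeeds, (hS.pivotal hiS hpos).2.trans ?_⟩
  rw [← contribution_filter_pos]
  exact mul_le_mul_of_nonneg_left contribution_le (G.m_pos i).le

theorem isCooperativeNash_empty (hτ : G.τ ≤ 0) : G.IsCooperativeNash ∅ :=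
  IsMinimal.isCooperativeNash ⟨hτ, by simp⟩ (by simp)

theorem IsBalanced.exists_isCooperativeNash_iff (hG : G.IsBalanced) (hl : ∀ i, i ∈ l)
    (hnodup : l.Nodup) (hsorted : l.Pairwise fun i j => G.e i ≤ G.e j) :
    (∃ S, G.IsCooperativeNash S) ↔ G.τ ≤ 0 ∨ ∃ i, G.Succeeds (G.greedySetBelow l i) ∧
      G.e i ≤ G.m i * G.contribution (G.greedySetBelow l i) := by
  constructor
  · rintro ⟨S, hS⟩
    exact (le_or_gt G.τ 0).imp_right fun hτ => hS.exists_greedySetBelow hG hτ hl hnodup hsorted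
  · rintro (hτ | ⟨i, succeeds, hi⟩)
    · exact ⟨∅, isCooperativeNash_empty hτ⟩
    · exact ⟨_, isCooperativeNash_greedySetBelow hnodup hsorted succeeds hi⟩

end PivotalGame

/-- The data of a game as fractions: `τ` stands for the threshold and `a i` for the agent `i`. -/
structure PivotalGame.IsGivenBy {n : ℕ} (G : PivotalGame n) (τ : Frac) (a : Fin n → Agent) :
    Prop where
  val_threshold : τ.val = G.τ
  val_endowment : ∀ i, (a i).1.val = G.e i
  val_reward : ∀ i, (a i).2.val = G.m i

namespace PivotalGame.IsGivenBy

variable {n : ℕ} {G : PivotalGame n} {τ : Frac} {a : Fin n → Agent} {l : List (Fin n)}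

theorem val_greedySum (h : G.IsGivenBy τ a) (hl : l.Nodup) :
    (Agent.greedySum τ (l.map a)).val = G.contribution (G.greedySet l) := by
  induction l with
  | nil => simp [Agent.greedySum, greedySet, contribution, Frac.val]
  | cons i l ih =>
    obtain ⟨hi, hl⟩ := List.nodup_cons.1 hl
    have le_iff : τ.le (Agent.greedySum τ (l.map a)) = true ↔ G.Succeeds (G.greedySet l) := by
      rw [Frac.le_eq_true, h.val_threshold, ih hl, Succeeds]
    rw [List.map_cons, Agent.greedySum, greedySet, cond_eq_ite]
    by_cases succeeds : G.Succeeds (G.greedySet l)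
    · rw [if_pos (le_iff.2 succeeds), if_pos succeeds, ih hl]
    · rw [if_neg (mt le_iff.1 succeeds), if_neg succeeds, Frac.val_add, ih hl, h.val_endowment,
        contribution_insert fun hmem => hi (mem_of_mem_greedySet hmem)]

theorem val_greedySumBelow (h : G.IsGivenBy τ a) (hl : l.Nodup) (i : Fin n) :
    (Agent.greedySumBelow τ (l.map a) (a i)).val =
      G.contribution (G.greedySetBelow (l.insertionSort fun j k => G.e j ≤ G.e k) i) := by
  have sorted : (l.map a).insertionSort (fun j k => j.1.le k.1) =
      (l.insertionSort fun j k => G.e j ≤ G.e k).map a :=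
    (List.map_insertionSort _ _ _ _ fun j _ k _ => by
      rw [Frac.le_eq_true, h.val_endowment, h.val_endowment]).symm
  have demandGE_eq : (a i).demandGE ∘ a = fun j => decide (G.e j * G.m i ≤ G.e i * G.m j) := by
    ext j
    rw [Bool.eq_iff_iff, decide_eq_true_iff, Function.comp_apply, Agent.demandGE,
      Frac.le_eq_true, Frac.val_mul, Frac.val_mul]
    simp only [h.val_endowment, h.val_reward]
  rw [Agent.greedySumBelow, sorted, List.filter_map, demandGE_eq,
    h.val_greedySum (((List.perm_insertionSort _ _).nodup_iff.2 hl).filter _), greedySetBelow]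

theorem accepts_iff (h : G.IsGivenBy τ a) (hG : G.IsBalanced) :
    Agent.accepts τ ((List.finRange n).map a) = true ↔ ∃ S, G.IsCooperativeNash S := by
  have nodup := List.nodup_finRange n
  have perm := List.perm_insertionSort (fun j k => G.e j ≤ G.e k) (List.finRange n)
  rw [hG.exists_isCooperativeNash_iff (fun i => perm.mem_iff.2 (List.mem_finRange i))
    (perm.nodup_iff.2 nodup) (List.pairwise_insertionSort _ _)]
  simp [Agent.accepts, Frac.le_eq_true, Frac.val_mul, h.val_greedySumBelow nodup,
    h.val_threshold, h.val_endowment, h.val_reward, Frac.val_nil, Succeeds]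

end PivotalGame.IsGivenBy

/-! ### Reading the input -/

/-- The binary digit that a symbol stands for, if any. All other symbols of the input delimit
numbers, and there is no need to tell them apart. -/
def symbolBits : Γ' → List Bool
  | .bit b => [b]
  | _ => []

instance : Enc Γ' := ⟨fun x => enc (symbolBits x)⟩

namespace Prog

/-- Push the word that represents the symbol in the register `cur`. -/
def pushSymbol : Prog :=
  cond (· == some (.bit true)) (pushWord (word (.bit true : Γ')))
    (cond (· == some (.bit false)) (pushWord (word (.bit false : Γ'))) (pushWord (word Γ'.blank)))

/-- Replace the input by a word that represents the list of its symbols, the last one first. -/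
def readInput : Prog :=
  pushWord (word ([] : List Γ')) ;; pop .input ;;
    loop Option.isSome (pushSymbol ;; pushSym .main .bra ;; pop .input)

end Prog

theorem Run.pushSymbol (x : Γ') (i A B C N : List Γ') :
    Run .pushSymbol ⟨some x, i, A, B, C, N⟩ ⟨some x, i, word x ++ A, B, C, N⟩ 7 := by
  have push (y : Γ') := Run.pushWord (word y) (some x) i A B C N
  rcases x with _ | (_ | _) | _ | _ | _
  case bit.true => exact (Run.cond_true rfl (push (.bit true))).weaken (by decide)
  case bit.false =>
    exact (Run.cond_false rfl (Run.cond_true rfl (push (.bit false)))).weaken (by decide)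
  all_goals exact (Run.cond_false rfl (Run.cond_false rfl (push .blank))).weaken (by decide)

theorem Run.readInput (w : List Γ') :
    Run .readInput ⟨none, w, [], [], [], []⟩ ⟨none, [], word w.reverse, [], [], []⟩
      (10 * w.length + 4) := by
  suffices loop : ∀ w l : List Γ', Run
      (.loop Option.isSome (.pushSymbol ;; .pushSym .main .bra ;; .pop .input))
      ⟨w.head?, w.tail, word l, [], [], []⟩ ⟨none, [], word (w.reverse ++ l), [], [], []⟩
      (10 * w.length + 1) by
    have loop := loop w []
    rw [List.append_nil] at loop
    exact (((Run.pushWord [.ket] none w [] [] [] []).seq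
      ((Run.pop .input _).seq loop)).weaken (by rw [List.length_singleton]; lia))
  intro w
  induction w with
  | nil => exact fun l => .loop_done rfl
  | cons x w ih =>
    intro l
    rw [List.reverse_cons, List.append_assoc]
    exact (Run.loop_step rfl ((Run.pushSymbol x _ _ _ _ _).seq ((Run.push _ _ _).seq (.pop _ _)))
      (ih (x :: l))).weaken (by rw [List.length_cons]; lia)

-- `true` is the word `bra ket ket` and `false` the word `ket`.
theorem Run.pop_word_bool (v : Option Γ') (b : Bool) :
    Run (.pop .main ;; .pop .main ;; .pop .main) ⟨v, [], word b, [], [], []⟩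
      ⟨bif b then some .ket else none, [], [], [], [], []⟩ 3 := by
  cases b <;> exact (Run.pop _ _).seq ((Run.pop _ _).seq (.pop _ _))

theorem Enc.esize_symbol_le (x : Γ') : esize x ≤ 5 := by
  rcases x with _ | (_ | _) | _ | _ | _ <;> decide

theorem InP.of_polyTime {f : List Γ' → Bool} (hf : PolyTime f) : InP {w | f w = true} := by
  obtain ⟨-, P, p, hP⟩ := hf.comp .reverse
  refine .of_run (.readInput ;; P ;; .pop .main ;; .pop .main ;; .pop .main) .ket
    (10 * .X + 4 + (p.comp (6 * .X + 1) + 3)) fun w => ⟨bif f w then some .ket else none, ?_, ?_⟩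
  · obtain ⟨v, run⟩ := hP w.reverse none [] [] [] []
    simp only [List.append_nil, List.reverse_reverse] at run
    refine ((Run.readInput w).seq (run.seq (.pop_word_bool v (f w)))).weaken ?_
    have size_le : esize w.reverse ≤ 6 * w.length + 1 := by
      simpa [mul_comm] using esize_le_of_forall_mem (l := w.reverse) fun x _ => esize_symbol_le x
    simpa using monotone_eval_polynomial p size_le
  · change _ ↔ f w = true
    cases f w <;> simp

/-- Read a symbol in front of a sequence of numbers: a binary digit extends the first number, any
other symbol starts a new one. -/
def prependSymbol (x : Γ') (l : List ℕ) : List ℕ :=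
  match symbolBits x, l with
  | [], l => 0 :: l
  | _ :: _, [] => []
  | b :: _, k :: l => Nat.bit b k :: l

/-- The numbers that are written in binary in a string, the least significant digits first. -/
def parseFields (w : List Γ') : List ℕ := w.foldr prependSymbol []

/-- Split a list into consecutive pairs, ignoring a last entry without partner. -/
def pairs {α : Type} : List α → List (α × α)
  | x :: y :: l => (x, y) :: pairs l
  | _ => []

/-- Numerator and denominator as a fraction. -/
def toFrac (p : ℕ × ℕ) : Frac := (p.1, p.2.toPNat')

/-- Run the decision algorithm on the threshold and the agents that a string describes. -/
def decideInput (w : List Γ') : Bool :=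
  match (pairs (parseFields w)).map toFrac with
  | [] => false
  | τ :: l => Agent.accepts τ (pairs l)

namespace Enc

variable {α : Type} [Enc α]

theorem esize_bit_le (b : Bool) (k : ℕ) : esize (Nat.bit b k) ≤ esize k + 4 := by
  change esize (Nat.bit b k).bits ≤ esize k.bits + 4
  rcases eq_or_ne k 0 with rfl | hk
  · cases b <;> simp [esize_cons, esize_nil, show esize true = 3 from rfl]
  · rw [Nat.bits_append_bit k b fun h => absurd h hk, esize_cons]
    have := esize_bool_le b
    lia

theorem esize_prependSymbol_le (x : Γ') (l : List ℕ) :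
    esize (prependSymbol x l) ≤ esize l + 4 := by
  have delimiter : esize (0 :: l) ≤ esize l + 4 := by
    rw [esize_cons]
    change 1 + _ + 1 ≤ _
    lia
  rcases x with _ | b | _ | _ | _
  case bit =>
    rcases l with _ | ⟨k, l⟩
    · exact Nat.le_add_right _ _
    · have := esize_bit_le b k
      change esize (Nat.bit b k :: l) ≤ _
      rw [esize_cons, esize_cons]
      lia
  all_goals exact delimiter

theorem esize_parseFields_le (w : List Γ') : esize (parseFields w) ≤ 4 * w.length + 1 := by
  induction w with
  | nil => rfl
  | cons x w ih => exact (esize_prependSymbol_le _ _).trans (Nat.add_le_add_right ih 4)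

theorem esize_pairs_le (l : List α) : esize (pairs l) ≤ esize l := by
  induction l using pairs.induct with
  | case1 x y l ih =>
    rw [pairs, esize_cons, esize_cons, esize_cons, esize_pair]
    lia
  | case2 l h =>
    rw [pairs.eq_2 l h]
    exact one_le_esize l

end Enc

namespace PolyTime

variable {α β : Type} [Enc α] [Enc β]

theorem prependSymbol : PolyTime fun y : Γ' × List ℕ => prependSymbol y.1 y.2 := by
  have symbolBits : PolyTime symbolBits := PolyTime.id.of_enc_eq fun _ => rfl
  have extend : PolyTime fun y : List ℕ × Bool =>
      match y.1 with | [] => [] | k :: l => Nat.bit y.2 k :: l :=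
    listCases nil ((bit snd (fst.comp fst)).cons (snd.comp fst))
  have cases : PolyTime fun y : List Bool × List ℕ =>
      match y.1, y.2 with
      | [], l => 0 :: l
      | _ :: _, [] => []
      | b :: _, k :: l => Nat.bit b k :: l := by
    refine listCases ((const 0).cons .id) ?_
    convert extend.comp (snd.pair (fst.comp fst)) using 2 with y
    rcases y with ⟨⟨b, t⟩, _ | ⟨k, l⟩⟩ <;> rfl
  exact cases.comp ((symbolBits.comp fst).pair snd)

theorem parseFields : PolyTime parseFields := by
  refine (listRec (f := fun (_ : Unit) w => _root_.parseFields w)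
    (g := fun y => _root_.prependSymbol y.2.1 y.2.2.2) nil
    (prependSymbol.comp ((fst.comp snd).pair (snd.comp (snd.comp snd)))) (fun _ _ _ => rfl)
    (((PolyBounded.const 4).mul .esize).mono fun ⟨_, w⟩ => ?_)).comp ((const ()).pair .id)
  have := esize_parseFields_le w
  have := length_lt_esize w
  rw [esize_pair]
  lia

theorem pairs : PolyTime (pairs : List α → List (α × α)) := by
  let withHead (b : α) (t : List α) (p : List (α × α)) : List (α × α) :=
    match t with | [] => [] | c :: _ => (b, c) :: p
  have hwithHead : PolyTime fun y : List α × α × List (α × α) => withHead y.2.1 y.1 y.2.2 :=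
    listCases nil (((fst.comp snd).pair (fst.comp fst)).cons (snd.comp snd))
  have pairs_and_tail : PolyTime fun y : Unit × List α =>
      (_root_.pairs y.2, _root_.pairs y.2.tail) := by
    refine listRec (f := fun _ l => (_root_.pairs l, _root_.pairs l.tail))
      (g := fun y => (withHead y.2.1 y.2.2.1 y.2.2.2.2, y.2.2.2.1)) (const ([], []))
      ((hwithHead.comp ((fst.comp (snd.comp snd)).pair ((fst.comp snd).pair
        (snd.comp (snd.comp (snd.comp snd)))))).pair (fst.comp (snd.comp (snd.comp snd))))
      (fun _ b t => by cases t <;> rfl) ((PolyBounded.const 2).mul .esize |>.mono fun ⟨_, l⟩ => ?_)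
    have := esize_pairs_le l
    have := esize_pairs_le l.tail
    have := esize_le_of_sublist l.tail_sublist
    rw [esize_pair, esize_pair]
    lia
  exact fst.comp (pairs_and_tail.comp ((const ()).pair .id))

theorem decideInput : PolyTime decideInput := by
  have toFrac : PolyTime toFrac := fst.pair (toPNat'.comp snd)
  have decide : PolyTime fun y : List Frac × Unit =>
      match y.1 with | [] => false | τ :: l => Agent.accepts τ (_root_.pairs l) :=
    listCases (const false) (accepts.comp ((fst.comp fst).pair (pairs.comp (snd.comp fst))))
  exact decide.comp ((toFrac.map.comp (pairs.comp parseFields)).pair (const ()))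

end PolyTime

theorem pairs_flatMap {α β : Type} (f g : α → β) (l : List α) :
    pairs (l.flatMap fun x => [f x, g x]) = l.map fun x => (f x, g x) := by
  induction l with
  | nil => rfl
  | cons x l ih => exact congrArg _ ih

theorem foldr_bit_encodeNat (k : ℕ) : (encodeNat k).foldr Nat.bit 0 = k := by
  have posNum (p : PosNum) : (encodePosNum p).foldr Nat.bit 0 = (p : ℕ) := by
    induction p with
    | one => rfl
    | bit0 p ih => rw [encodePosNum, List.foldr_cons, ih, PosNum.cast_bit0, Nat.bit_false]; lia
    | bit1 p ih => rw [encodePosNum, List.foldr_cons, ih, PosNum.cast_bit1, Nat.bit_true]; lia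
  have num (x : Num) : (encodeNum x).foldr Nat.bit 0 = (x : ℕ) := by
    cases x
    exacts [rfl, posNum _]
  rw [encodeNat, num, Num.to_of_nat]

namespace RationalInstance

theorem parseFields_flatMap_encodeNatField (l : List ℕ) :
    parseFields (l.flatMap encodeNatField) = l := by
  have field (d : List Bool) (w : List Γ') :
      parseFields (d.map Γ'.bit ++ .comma :: w) = d.foldr Nat.bit 0 :: parseFields w := by
    induction d with
    | nil => rfl
    | cons b d ih =>
      exact congrArg (prependSymbol (.bit b)) ih
  induction l with
  | nil => rfl
  | cons k l ih =>
    rw [List.flatMap_cons, encodeNatField, List.append_assoc, List.singleton_append, field,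
      foldr_bit_encodeNat, ih]

variable (I : RationalInstance)

/-- The agents of an instance as input of the decision algorithm. -/
def agent (i : Fin I.n) : Agent := (Frac.ofRat (I.e i), Frac.ofRat (I.m i))

theorem decideInput_encode :
    decideInput I.encode =
      Agent.accepts (Frac.ofRat I.τ) ((List.finRange I.n).map I.agent) := by
  have toFrac_ratData (q : ℚ) : toFrac (q.num.toNat, q.den) = Frac.ofRat q :=
    Prod.ext rfl (PNat.coe_toPNat' ⟨q.den, q.den_pos⟩)
  have data_eq : I.data = (I.τ :: (List.finRange I.n).flatMap fun i => [I.e i, I.m i]).flatMap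
      fun q => [q.num.toNat, q.den] := by
    simp [data, ratData, List.flatMap_assoc]
  have fracs : (pairs (parseFields I.encode)).map toFrac = Frac.ofRat I.τ ::
      (List.finRange I.n).flatMap fun i => [Frac.ofRat (I.e i), Frac.ofRat (I.m i)] := by
    rw [encode, parseFields_flatMap_encodeNatField, data_eq, pairs_flatMap, List.map_map]
    simp [Function.comp_def, toFrac_ratData, List.map_flatMap]
  rw [decideInput, fracs]
  exact congrArg (Agent.accepts _) (pairs_flatMap _ _ _)

theorem isGivenBy_agent : I.toGame.IsGivenBy (Frac.ofRat I.τ) I.agent where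
  val_threshold := Frac.val_ofRat I.τ_nonneg
  val_endowment i := Frac.val_ofRat (I.e_nonneg i)
  val_reward i := Frac.val_ofRat (I.m_pos i).le

end RationalInstance

theorem mainTheorem6 :
    ∃ L : Language Computability.Γ', InP L ∧
      ∀ I : RationalInstance, I.toGame.IsBalanced →
        (I.encode ∈ L ↔ ∃ S : Finset (Fin I.n), I.toGame.IsCooperativeNash S) := by
  refine ⟨{w | decideInput w = true}, .of_polyTime .decideInput, fun I hI => ?_⟩
  change decideInput I.encode = true ↔ _
  rw [I.decideInput_encode]
  exact I.isGivenBy_agent.accepts_iff hI
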